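/- Let $n\ge 1$, let $\Omega\subset\mathbb R^n$ be a bounded domain (nonempty, open, connected), let $F:\Omega\to\mathbb R$ be continuous and bounded, and let $g:\partial\Omega\to\mathbb R$ be continuous (hence bounded). For $\phi\in C^2(\Omega)$ put $$\Delta_\infty\phi=\sum_{i,j=1}^n\frac{\partial \phi}{\partial x_i}\frac{\partial \phi}{\partial x_j}\frac{\partial^2\phi}{\partial x_i\partial x_j}.$$ A lower semicontinuous $v:\Omega\to(-\infty,\infty]$ is a viscosity supersolution of $\Delta_\infty v=F$ in $\Omega$ if $\Delta_\infty\phi(x_0)\le F(x_0)$ whenever $x_0\in\Omega$, $\phi\in C^2(\Omega)$, $\phi(x_0)=v(x_0)$ and $\phi(x)<v(x)$ for all $x\in\Omega\setminus\{x_0\}$. An upper semicontinuous $u:\Omega\to[-\infty,\infty)$ is a viscosity subsolution if $\Delta_\infty\psi(x_0)\ge F(x_0)$ whenever $x_0\in\Omega$, $\psi\in C^2(\Omega)$, $\psi(x_0)=u(x_0)$ and $\psi(x)>u(x)$ for all $x\in\Omega\setminus\{x_0\}$. A viscosity solution is a (finite) continuous function on $\Omega$ that is both. Let $$\overline H(x)=\inf_{v\in\mathfrak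 U}v(x),\qquad \underline H(x)=\sup_{u\in\mathfrak L}u(x)\qquad(x\in\Omega),$$ where $\mathfrak U$ is the class of all viscosity supersolutions $v$ in $\Omega$ with $\liminf_{x\to\xi}v(x)\ge g(\xi)$ for every $\xi\in\partial\Omega$, and $\mathfrak L$ is the class of all viscosity subsolutions $u$ in $\Omega$ with $\limsup_{x\to\xi}u(x)\le g(\xi)$ for every $\xi\in\partial\Omega$ (the limits are taken with $x\in\Omega$). Theorem. 1. $\overline H$ and $\underline H$ are viscosity solutions of $\Delta_\infty h=F$ in $\Omega$, and $\lim_{x\to\xi}\overline H(x)=g(\xi)=\lim_{x\to\xi}\underline H(x)$ for every $\xi\in\partial\Omega$. 2. Every viscosity solution $h$ of $\Delta_\infty h=F$ in $\Omega$ with $\lim_{x\to\xi}h(x)=g(\xi)$ for every $\xi\in\partial\Omega$ satisfies $\overline H\le h\le\underline H$ in $\Omega$. 3. If $F$ is bounded away from $0$ (there is $c>0$ with $|F|\ge c$ in $\Omega$) or $F\equiv0$ in $\Omega$, then $\overline H=\underline H$ in $\Omega$, and any two viscosity solutions of $\Delta_\infty h=F$ in $\Omega$ with boundary values $g$ (in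 the sense of part 2) coincide in $\Omega$. -/

import Mathlib

open Filter Topology

noncomputable section

namespace InfPoisson

/-- The partial derivative `∂φ/∂xᵢ` at `x`. -/
def partialDeriv {n : ℕ} (i : Fin n) (φ : EuclideanSpace ℝ (Fin n) → ℝ)
    (x : EuclideanSpace ℝ (Fin n)) : ℝ :=
  fderiv ℝ φ x (EuclideanSpace.single i 1)

/-- The `∞`-Laplacian `Δ_∞ φ = ∑ᵢⱼ φ_{xᵢ} φ_{xⱼ} φ_{xᵢxⱼ}` at `x`. -/
def infLaplacian {n : ℕ} (φ : EuclideanSpace ℝ (Fin n) → ℝ)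
    (x : EuclideanSpace ℝ (Fin n)) : ℝ :=
  ∑ i, ∑ j, partialDeriv i φ x * partialDeriv j φ x * partialDeriv i (partialDeriv j φ) x

/-- `φ` touches `v` (strictly) from below at `x₀`, relative to `Ω`. -/
def TouchesFromBelow {n : ℕ} (Ω : Set (EuclideanSpace ℝ (Fin n)))
    (φ : EuclideanSpace ℝ (Fin n) → ℝ) (v : EuclideanSpace ℝ (Fin n) → EReal)
    (x₀ : EuclideanSpace ℝ (Fin n)) : Prop :=
  v x₀ = (φ x₀ : EReal) ∧ ∀ x ∈ Ω, x ≠ x₀ → (φ x : EReal) < v x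

/-- `ψ` touches `u` (strictly) from above at `x₀`, relative to `Ω`. -/
def TouchesFromAbove {n : ℕ} (Ω : Set (EuclideanSpace ℝ (Fin n)))
    (ψ : EuclideanSpace ℝ (Fin n) → ℝ) (u : EuclideanSpace ℝ (Fin n) → EReal)
    (x₀ : EuclideanSpace ℝ (Fin n)) : Prop :=
  u x₀ = (ψ x₀ : EReal) ∧ ∀ x ∈ Ω, x ≠ x₀ → u x < (ψ x : EReal)

/-- Viscosity supersolutions of `Δ_∞ v = F` in `Ω`: lower semicontinuous functions with values
in `(-∞, ∞]`. Only the values of `v` and `F` on `Ω` matter. -/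
structure IsViscositySupersolution {n : ℕ} (Ω : Set (EuclideanSpace ℝ (Fin n)))
    (F : EuclideanSpace ℝ (Fin n) → ℝ) (v : EuclideanSpace ℝ (Fin n) → EReal) : Prop where
  ne_bot : ∀ x ∈ Ω, v x ≠ ⊥
  lsc : LowerSemicontinuousOn v Ω
  le_of_touches : ∀ x₀ ∈ Ω, ∀ φ : EuclideanSpace ℝ (Fin n) → ℝ, ContDiffOn ℝ 2 φ Ω →
    TouchesFromBelow Ω φ v x₀ → infLaplacian φ x₀ ≤ F x₀

/-- Viscosity subsolutions of `Δ_∞ u = F` in `Ω`: upper semicontinuous functions with values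
in `[-∞, ∞)`. -/
structure IsViscositySubsolution {n : ℕ} (Ω : Set (EuclideanSpace ℝ (Fin n)))
    (F : EuclideanSpace ℝ (Fin n) → ℝ) (u : EuclideanSpace ℝ (Fin n) → EReal) : Prop where
  ne_top : ∀ x ∈ Ω, u x ≠ ⊤
  usc : UpperSemicontinuousOn u Ω
  ge_of_touches : ∀ x₀ ∈ Ω, ∀ ψ : EuclideanSpace ℝ (Fin n) → ℝ, ContDiffOn ℝ 2 ψ Ω →
    TouchesFromAbove Ω ψ u x₀ → F x₀ ≤ infLaplacian ψ x₀

/-- Viscosity solutions of `Δ_∞ h = F` in `Ω`: continuous functions that are both viscosity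
supersolutions and viscosity subsolutions. Such `h` is finite on `Ω`, since a supersolution
omits the value `-∞` and a subsolution omits the value `+∞`. -/
structure IsViscositySolution {n : ℕ} (Ω : Set (EuclideanSpace ℝ (Fin n)))
    (F : EuclideanSpace ℝ (Fin n) → ℝ) (h : EuclideanSpace ℝ (Fin n) → EReal) : Prop where
  continuousOn : ContinuousOn h Ω
  supersolution : IsViscositySupersolution Ω F h
  subsolution : IsViscositySubsolution Ω F h

/-- `h` takes the boundary values `g` in the classical sense at every boundary point of `Ω`. -/
def HasBoundaryValues {n : ℕ} (Ω : Set (EuclideanSpace ℝ (Fin n)))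
    (g : EuclideanSpace ℝ (Fin n) → ℝ) (h : EuclideanSpace ℝ (Fin n) → EReal) : Prop :=
  ∀ ξ ∈ frontier Ω, Tendsto h (𝓝[Ω] ξ) (𝓝 (g ξ : EReal))

/-- The Perron upper class. -/
def upperClass {n : ℕ} (Ω : Set (EuclideanSpace ℝ (Fin n)))
    (F g : EuclideanSpace ℝ (Fin n) → ℝ) : Set (EuclideanSpace ℝ (Fin n) → EReal) :=
  {v | IsViscositySupersolution Ω F v ∧ ∀ ξ ∈ frontier Ω, (g ξ : EReal) ≤ liminf v (𝓝[Ω] ξ)}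

/-- The Perron lower class. -/
def lowerClass {n : ℕ} (Ω : Set (EuclideanSpace ℝ (Fin n)))
    (F g : EuclideanSpace ℝ (Fin n) → ℝ) : Set (EuclideanSpace ℝ (Fin n) → EReal) :=
  {u | IsViscositySubsolution Ω F u ∧ ∀ ξ ∈ frontier Ω, limsup u (𝓝[Ω] ξ) ≤ (g ξ : EReal)}

/-- The upper Perron solution: the pointwise infimum (in `[-∞, ∞]`) over the upper class. -/
def upperPerron {n : ℕ} (Ω : Set (EuclideanSpace ℝ (Fin n)))
    (F g : EuclideanSpace ℝ (Fin n) → ℝ) (x : EuclideanSpace ℝ (Fin n)) : EReal :=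
  ⨅ v ∈ upperClass Ω F g, v x

/-- The lower Perron solution: the pointwise supremum (in `[-∞, ∞]`) over the lower class. -/
def lowerPerron {n : ℕ} (Ω : Set (EuclideanSpace ℝ (Fin n)))
    (F g : EuclideanSpace ℝ (Fin n) → ℝ) (x : EuclideanSpace ℝ (Fin n)) : EReal :=
  ⨆ u ∈ lowerClass Ω F g, u x

end InfPoisson

end

open Set Metric

namespace InfPoisson

variable {n : ℕ}

local notation "𝔼" => EuclideanSpace ℝ (Fin n)

/-! ### The ∞-Laplacian of functions of class `C²` -/

/-! The test functions throughout are the radial parabolas `A + B r + C r ^ 2`, whose `∞`-Laplacian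
`2 C (B + 2 C r) ^ 2` has the sign of `C` and is large where the slope is. They serve as barriers at
every boundary point and as comparison cones inside `Ω`.

Existence is Perron's method. Truncated by one fixed upper barrier and bounded below by a lower
barrier, the real-valued upper class is uniformly bounded, so comparison with parabolas makes its
members locally equi-Lipschitz (`IsSuper.sub_mul_norm_le`). The infimum is therefore continuous in
`Ω`, and the barriers give it boundary values `g`. It is a supersolution as an infimum of
supersolutions, and a subsolution because otherwise it could be lowered near a point
(`isSuper_perronInf`, `isSub_perronInf`). Thus `exists_minimal_solution` identifies the upper Perron
function, and oddness of `Δ_∞` gives the lower one. Every solution with boundary values `g` belongs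
to both Perron classes, which proves part 2.

Uniqueness avoids doubling of variables with a penalty. One maximizes `u x - v y` subject to `dist x
y ≤ R` and places `z` at the midpoint of a maximal pair. If `m` and `k` denote the maxima of `u` and
`-v` over balls about `z`, then `m s + k (R - s)` is maximal at `s = R / 2`. Formally `m'' m' ^ 2 ≥
f₁`, `k'' k' ^ 2 ≥ -f₂`, and at the maximum `m' = k'` and `m'' + k'' ≤ 0`, which forbids `f₂ < f₁`;
`false_of_max_dist_le` is the finite-difference version. For `F > 0` the solution `h` is scaled to
`(1 + ε) h`, which makes the right-hand sides strictly ordered because `Δ_∞` is homogeneous of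
degree 3. For `F = 0`, convexity of `m` and `k` spreads a maximal pair of values over a set that is
open and closed (`eq_center_of_max`, `sub_le_of_zero`). -/

lemma infLaplacian_eq {φ : 𝔼 → ℝ} {x : 𝔼} (hφ : ContDiffAt ℝ 2 φ x) :
    infLaplacian φ x = fderiv ℝ (fderiv ℝ φ) x (gradient φ x) (gradient φ x) := by
  have hd : DifferentiableAt ℝ (fderiv ℝ φ) x :=
    (hφ.fderiv_right (m := 1) (by norm_num)).differentiableAt (by norm_num)
  have h2 : ∀ i j, partialDeriv i (partialDeriv j φ) x
      = fderiv ℝ (fderiv ℝ φ) x (EuclideanSpace.single i 1) (EuclideanSpace.single j 1) := by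
    intro i j
    have : HasFDerivAt (partialDeriv j φ)
        ((fderiv ℝ (fderiv ℝ φ) x).flip (EuclideanSpace.single j 1)) x := by
      have h := hd.hasFDerivAt.clm_apply
        (hasFDerivAt_const (EuclideanSpace.single j (1 : ℝ)) x)
      refine HasFDerivAt.congr_fderiv h ?_
      simp
    rw [partialDeriv, this.fderiv]
    rfl
  have h1 : gradient φ x = ∑ i, partialDeriv i φ x • EuclideanSpace.single i (1 : ℝ) := by
    have h := (EuclideanSpace.basisFun (Fin n) ℝ).sum_repr' (gradient φ x)
    rw [← h]
    refine Finset.sum_congr rfl fun i _ => ?_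
    rw [EuclideanSpace.basisFun_apply, real_inner_comm, inner_gradient_left, partialDeriv]
  rw [infLaplacian, h1]
  simp only [map_sum, map_smul, sum_apply, smul_apply, smul_eq_mul,
    Finset.mul_sum, h2]
  rw [Finset.sum_comm]
  refine Finset.sum_congr rfl fun i _ => Finset.sum_congr rfl fun j _ => ?_
  ring

lemma eventually_hasDerivAt_line {φ : 𝔼 → ℝ} {x : 𝔼} (hφ : ContDiffAt ℝ 2 φ x) (p : 𝔼) :
    ∀ᶠ t : ℝ in 𝓝 0, HasDerivAt (fun s : ℝ => φ (x + s • p)) (fderiv ℝ φ (x + t • p) p) t := by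
  have hc : Tendsto (fun t : ℝ => x + t • p) (𝓝 0) (𝓝 x) := by
    have : Continuous fun t : ℝ => x + t • p := by fun_prop
    simpa using this.tendsto 0
  filter_upwards [hc.eventually (hφ.eventually (by simp))] with t ht
  have hl : HasDerivAt (fun s : ℝ => x + s • p) p t := by
    simpa using ((hasDerivAt_id t).smul_const p).const_add x
  exact (ht.differentiableAt (by norm_num)).hasFDerivAt.comp_hasDerivAt t hl

lemma hasDerivAt_deriv_line {φ : 𝔼 → ℝ} {x : 𝔼} (hφ : ContDiffAt ℝ 2 φ x) (p : 𝔼) :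
    HasDerivAt (deriv fun s : ℝ => φ (x + s • p)) (fderiv ℝ (fderiv ℝ φ) x p p) 0 := by
  have h : (deriv fun s : ℝ => φ (x + s • p)) =ᶠ[𝓝 0] fun t => fderiv ℝ φ (x + t • p) p :=
    (eventually_hasDerivAt_line hφ p).mono fun t ht => ht.deriv
  refine HasDerivAt.congr_of_eventuallyEq ?_ h
  have hd : HasFDerivAt (fun y => fderiv ℝ φ y p) ((fderiv ℝ (fderiv ℝ φ) x).flip p) x := by
    have h := ((hφ.fderiv_right (m := 1) (by norm_num)).differentiableAt
      (by norm_num)).hasFDerivAt.clm_apply (hasFDerivAt_const p x)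
    refine HasFDerivAt.congr_fderiv h ?_
    simp
  have hl : HasDerivAt (fun s : ℝ => x + s • p) p 0 := by
    simpa using ((hasDerivAt_id (0 : ℝ)).smul_const p).const_add x
  exact hd.comp_hasDerivAt_of_eq 0 hl (by simp)

lemma infLaplacian_eq_deriv_deriv {φ : 𝔼 → ℝ} {x : 𝔼} (hφ : ContDiffAt ℝ 2 φ x) :
    infLaplacian φ x = deriv (deriv fun s : ℝ => φ (x + s • gradient φ x)) 0 := by
  rw [infLaplacian_eq hφ, (hasDerivAt_deriv_line hφ _).deriv]

/-- A negative second derivative would make `a` a local maximum as well, so `f` would be locally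
constant. -/
lemma deriv_deriv_nonneg_of_isLocalMin {f : ℝ → ℝ} {a : ℝ} (hf : ContinuousAt f a)
    (h : IsLocalMin f a) : 0 ≤ deriv (deriv f) a := by
  by_contra! hneg
  have hmax := isLocalMax_of_deriv_deriv_neg hneg h.deriv_eq_zero hf
  have hconst : f =ᶠ[𝓝 a] fun _ => f a := by
    filter_upwards [h, hmax] with x h1 h2 using le_antisymm h2 h1
  have : deriv f =ᶠ[𝓝 a] fun _ => 0 := by
    filter_upwards [hconst.eventuallyEq_nhds] with x hx
    rw [hx.deriv_eq]; simp
  rw [this.deriv_eq] at hneg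
  simp at hneg

/-- At a contact point the gradients agree and the Hessians are ordered; it suffices to look along
the line in the direction of the common gradient. -/
lemma infLaplacian_le_of_touches {φ ψ : 𝔼 → ℝ} {x : 𝔼} (hφ : ContDiffAt ℝ 2 φ x)
    (hψ : ContDiffAt ℝ 2 ψ x) (hx : φ x = ψ x) (hle : ∀ᶠ y in 𝓝 x, φ y ≤ ψ y) :
    infLaplacian φ x ≤ infLaplacian ψ x := by
  have hmin : IsLocalMin (ψ - φ) x := by
    filter_upwards [hle] with y hy
    simp only [Pi.sub_apply, hx]; linarith
  have hf : fderiv ℝ φ x = fderiv ℝ ψ x := by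
    have := hmin.fderiv_eq_zero
    rw [fderiv_sub (hψ.differentiableAt (by norm_num)) (hφ.differentiableAt (by norm_num))] at this
    exact (sub_eq_zero.1 this).symm
  have hg : gradient φ x = gradient ψ x := by simp only [gradient, hf]
  rw [infLaplacian_eq hφ, infLaplacian_eq hψ, hg]
  set p := gradient ψ x
  have hc : Tendsto (fun t : ℝ => x + t • p) (𝓝 0) (𝓝 x) := by
    have : Continuous fun t : ℝ => x + t • p := by fun_prop
    simpa using this.tendsto 0
  have hsub : ContDiffAt ℝ 2 (ψ - φ) x := hψ.sub hφ
  have hl := hasDerivAt_deriv_line hsub p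
  have hmin' : IsLocalMin (fun s : ℝ => (ψ - φ) (x + s • p)) 0 := by
    have := hc.eventually hmin
    filter_upwards [this] with t ht
    simpa using ht
  have h0 := deriv_deriv_nonneg_of_isLocalMin
    (eventually_hasDerivAt_line hsub p).self_of_nhds.continuousAt hmin'
  rw [hl.deriv] at h0
  have hd : ∀ {χ : 𝔼 → ℝ}, ContDiffAt ℝ 2 χ x → DifferentiableAt ℝ (fderiv ℝ χ) x := fun h =>
    (h.fderiv_right (m := 1) (by norm_num)).differentiableAt (by norm_num)
  have he : fderiv ℝ (ψ - φ) =ᶠ[𝓝 x] fderiv ℝ ψ - fderiv ℝ φ := by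
    filter_upwards [hφ.eventually (by simp), hψ.eventually (by simp)] with y h1 h2
    exact fderiv_sub (h2.differentiableAt (by norm_num)) (h1.differentiableAt (by norm_num))
  rw [he.fderiv_eq, fderiv_sub (hd hψ) (hd hφ)] at h0
  simpa using h0

lemma infLaplacian_congr {φ ψ : 𝔼 → ℝ} {x : 𝔼} (hφ : ContDiffAt ℝ 2 φ x)
    (h : φ =ᶠ[𝓝 x] ψ) : infLaplacian φ x = infLaplacian ψ x :=
  have hψ := hφ.congr_of_eventuallyEq h.symm
  le_antisymm (infLaplacian_le_of_touches hφ hψ h.self_of_nhds h.le)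
    (infLaplacian_le_of_touches hψ hφ h.self_of_nhds.symm h.symm.le)

lemma infLaplacian_const_mul (c : ℝ) (φ : 𝔼 → ℝ) (x : 𝔼) :
    infLaplacian (fun y => c * φ y) x = c ^ 3 * infLaplacian φ x := by
  have h1 : ∀ (i : Fin n) (χ : 𝔼 → ℝ),
      partialDeriv i (fun y => c * χ y) = fun y => c * partialDeriv i χ y := by
    intro i χ
    ext y
    have : (fun y => c * χ y) = c • χ := rfl
    rw [partialDeriv, this, fderiv_const_smul_field]
    rfl
  simp only [infLaplacian, h1, Finset.mul_sum]
  refine Finset.sum_congr rfl fun i _ => Finset.sum_congr rfl fun j _ => ?_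
  ring

lemma infLaplacian_neg (φ : 𝔼 → ℝ) (x : 𝔼) :
    infLaplacian (fun y => -φ y) x = -infLaplacian φ x := by
  have := infLaplacian_const_mul (-1) φ x
  simpa [neg_one_mul, Odd.neg_one_pow (by decide : Odd 3)] using this

lemma infLaplacian_add_const (φ : 𝔼 → ℝ) (c : ℝ) (x : 𝔼) :
    infLaplacian (fun y => φ y + c) x = infLaplacian φ x := by
  have h1 : ∀ i : Fin n, partialDeriv i (fun y => φ y + c) = partialDeriv i φ := by
    intro i
    ext y
    rw [partialDeriv, partialDeriv, fderiv_add_const]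
  simp only [infLaplacian, h1]

lemma continuousAt_infLaplacian {φ : 𝔼 → ℝ} {x : 𝔼} (hφ : ContDiffAt ℝ 2 φ x) :
    ContinuousAt (infLaplacian φ) x := by
  have h1 : infLaplacian φ =ᶠ[𝓝 x]
      fun y => fderiv ℝ (fderiv ℝ φ) y (gradient φ y) (gradient φ y) := by
    filter_upwards [hφ.eventually (by simp)] with y hy using infLaplacian_eq hy
  refine ContinuousAt.congr ?_ h1.symm
  have hd := hφ.fderiv_right (m := 1) (by norm_num)
  have hg : ContinuousAt (gradient φ) x :=
    (InnerProductSpace.toDual ℝ 𝔼).symm.continuous.continuousAt.comp hd.continuousAt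
  have hD : ContinuousAt (fderiv ℝ (fderiv ℝ φ)) x :=
    (hd.fderiv_right (m := 0) (by norm_num)).continuousAt
  exact (hD.clm_apply hg).clm_apply hg

/-! ### Quartic perturbations -/

lemma contDiff_norm_sub_pow_four (z : 𝔼) : ContDiff ℝ 2 fun x : 𝔼 => ‖x - z‖ ^ 4 := by
  have h : ContDiff ℝ 2 fun x : 𝔼 => (‖x - z‖ ^ 2) ^ 2 :=
    ((contDiff_id.sub contDiff_const).norm_sq ℝ).pow 2
  have he : (fun x : 𝔼 => ‖x - z‖ ^ 4) = fun x : 𝔼 => (‖x - z‖ ^ 2) ^ 2 := by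
    ext x; ring
  rwa [he]

/-- The quartic has vanishing first and second derivatives at `x`, so it makes contact strict at no
cost. -/
lemma infLaplacian_add_quartic {φ : 𝔼 → ℝ} {x : 𝔼} (hφ : ContDiffAt ℝ 2 φ x) (c : ℝ) :
    infLaplacian (fun y => φ y + c * ‖y - x‖ ^ 4) x = infLaplacian φ x := by
  set q : 𝔼 → ℝ := fun y => c * ‖y - x‖ ^ 4 with hq
  have hqc : ContDiffAt ℝ 2 q x :=
    (contDiff_const.mul (contDiff_norm_sub_pow_four x)).contDiffAt
  have hline : ∀ p : 𝔼, (fun s : ℝ => q (x + s • p)) = fun s => (c * ‖p‖ ^ 4) * s ^ 4 := by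
    intro p
    ext s
    have : |s| ^ 4 = s ^ 4 := by rw [Even.pow_abs (by decide)]
    simp only [hq, add_sub_cancel_left, norm_smul, Real.norm_eq_abs, mul_pow, this]
    ring
  have hD : ∀ p, fderiv ℝ (fderiv ℝ q) x p p = 0 := by
    intro p
    rw [← (hasDerivAt_deriv_line hqc p).deriv, hline]
    have : (deriv fun s : ℝ => (c * ‖p‖ ^ 4) * s ^ 4) = fun s => (c * ‖p‖ ^ 4) * (4 * s ^ 3) := by
      ext s; simp
    rw [this]; simp
  have hf0 : fderiv ℝ q x = 0 := by
    ext p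
    have h := (eventually_hasDerivAt_line hqc p).self_of_nhds
    rw [hline] at h
    have h' := h.deriv
    simp at h'
    simpa using h'.symm
  have hs : ContDiffAt ℝ 2 (φ + q) x := hφ.add hqc
  have hg : gradient (φ + q) x = gradient φ x := by
    simp only [gradient]
    rw [fderiv_add (hφ.differentiableAt (by norm_num)) (hqc.differentiableAt (by norm_num)), hf0,
      add_zero]
  have he : fderiv ℝ (φ + q) =ᶠ[𝓝 x] fderiv ℝ φ + fderiv ℝ q := by
    filter_upwards [hφ.eventually (by simp), hqc.eventually (by simp)] with y h1 h2
    exact fderiv_add (h1.differentiableAt (by norm_num)) (h2.differentiableAt (by norm_num))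
  have hd : ∀ {χ : 𝔼 → ℝ}, ContDiffAt ℝ 2 χ x → DifferentiableAt ℝ (fderiv ℝ χ) x := fun h =>
    (h.fderiv_right (m := 1) (by norm_num)).differentiableAt (by norm_num)
  change infLaplacian (φ + q) x = _
  rw [infLaplacian_eq hs, infLaplacian_eq hφ, hg, he.fderiv_eq, fderiv_add (hd hφ) (hd hqc)]
  simp [hD]

/-! ### Quadratic cones -/

/-- The radial function `A + B r + C r²` with `r = ‖x - z‖`. -/
noncomputable def quadCone (A B C : ℝ) (z x : 𝔼) : ℝ := A + B * ‖x - z‖ + C * ‖x - z‖ ^ 2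

lemma continuous_quadCone (A B C : ℝ) (z : 𝔼) : Continuous (quadCone A B C z) := by
  unfold quadCone; fun_prop

lemma contDiffAt_quadCone (A B C : ℝ) {z x : 𝔼} (hx : x ≠ z) :
    ContDiffAt ℝ 2 (quadCone A B C z) x := by
  have h1 : ContDiffAt ℝ 2 (fun y : 𝔼 => ‖y - z‖) x :=
    (contDiffAt_id.sub contDiffAt_const).norm ℝ (sub_ne_zero.2 hx)
  exact (contDiffAt_const.add (contDiffAt_const.mul h1)).add (contDiffAt_const.mul (h1.pow 2))

lemma gradient_quadCone (A B C : ℝ) {z x : 𝔼} (hx : x ≠ z) :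
    gradient (quadCone A B C z) x = ((B + 2 * C * ‖x - z‖) / ‖x - z‖) • (x - z) := by
  have hr : ‖x - z‖ ≠ 0 := norm_ne_zero_iff.2 (sub_ne_zero.2 hx)
  have h2 : HasFDerivAt (fun y : 𝔼 => ‖y - z‖ ^ 2) (2 • innerSL ℝ (x - z)) x := by
    have := ((hasFDerivAt_id (𝕜 := ℝ) x).sub_const z).norm_sq
    simpa using this
  have h1 : HasFDerivAt (fun y : 𝔼 => ‖y - z‖) ((1 / ‖x - z‖) • innerSL ℝ (x - z)) x := by
    have := h2.sqrt (by positivity)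
    simp only [Real.sqrt_sq (norm_nonneg _)] at this
    refine HasFDerivAt.congr_fderiv this ?_
    ext w
    simp
    field_simp
  have h := ((h1.const_mul B).const_add A).add (h2.const_mul C)
  have hgr : HasGradientAt (quadCone A B C z)
      (((B + 2 * C * ‖x - z‖) / ‖x - z‖) • (x - z)) x := by
    rw [hasGradientAt_iff_hasFDerivAt]
    refine HasFDerivAt.congr_fderiv h ?_
    ext w
    simp
    field_simp
  exact hgr.gradient

/-- For a radial function `f r` the value is `f'' f' ^ 2`: the gradient is radial, so only the
second derivative along the ray enters. -/
lemma infLaplacian_quadCone (A B C : ℝ) {z x : 𝔼} (hx : x ≠ z) :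
    infLaplacian (quadCone A B C z) x = 2 * C * (B + 2 * C * ‖x - z‖) ^ 2 := by
  rw [infLaplacian_eq_deriv_deriv (contDiffAt_quadCone A B C hx), gradient_quadCone A B C hx]
  set r := ‖x - z‖ with hrdef
  have hr : r ≠ 0 := norm_ne_zero_iff.2 (sub_ne_zero.2 hx)
  set k := (B + 2 * C * r) / r with hk
  have hev : ∀ᶠ t : ℝ in 𝓝 0, 0 < 1 + t * k := by
    have : ContinuousAt (fun t : ℝ => 1 + t * k) 0 := by fun_prop
    exact this.eventually (lt_mem_nhds (by simp))
  have h0 : (fun s : ℝ => quadCone A B C z (x + s • k • (x - z))) =ᶠ[𝓝 0]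
      fun s => A + B * (r * (1 + s * k)) + C * (r * (1 + s * k)) ^ 2 := by
    filter_upwards [hev] with s hs
    have : x + s • k • (x - z) - z = (1 + s * k) • (x - z) := by
      rw [add_smul, one_smul, mul_smul]; abel
    rw [quadCone, this, norm_smul, Real.norm_eq_abs, abs_of_pos hs, ← hrdef]
    ring
  have h1 : ∀ s, HasDerivAt (fun s => A + B * (r * (1 + s * k)) + C * (r * (1 + s * k)) ^ 2)
      (B * (r * k) + C * (2 * (r * (1 + s * k)) * (r * k))) s := by
    intro s
    have hb : HasDerivAt (fun s : ℝ => r * (1 + s * k)) (r * k) s := by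
      simpa using (((hasDerivAt_id s).mul_const k).const_add 1).const_mul r
    refine HasDerivAt.congr_deriv (((hb.const_mul B).const_add A).add ((hb.pow 2).const_mul C)) ?_
    simp
  rw [(h0.deriv).deriv_eq]
  have h2 : (deriv fun s => A + B * (r * (1 + s * k)) + C * (r * (1 + s * k)) ^ 2)
      = fun s => B * (r * k) + C * (2 * (r * (1 + s * k)) * (r * k)) := by
    ext s; exact (h1 s).deriv
  rw [h2]
  have h3 : HasDerivAt (fun s => B * (r * k) + C * (2 * (r * (1 + s * k)) * (r * k)))
      (C * (2 * (r * k) * (r * k))) 0 := by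
    have hb : HasDerivAt (fun s : ℝ => r * (1 + s * k)) (r * k) 0 := by
      simpa using (((hasDerivAt_id (0 : ℝ)).mul_const k).const_add 1).const_mul r
    exact (((hb.const_mul 2).mul_const (r * k)).const_mul C).const_add _
  rw [h3.deriv]
  have : r * k = B + 2 * C * r := by rw [hk]; field_simp
  rw [this]; ring

section

/-! ### Real-valued viscosity sub- and supersolutions with local test functions -/

/-- Real-valued supersolutions of `Δ_∞ v = F` at the points of `Ω`, with local test functions. -/
def IsSuper (Ω : Set 𝔼) (F v : 𝔼 → ℝ) : Prop :=
  ∀ x₀ ∈ Ω, ∀ φ : 𝔼 → ℝ, ContDiffAt ℝ 2 φ x₀ → φ x₀ = v x₀ → (∀ᶠ x in 𝓝 x₀, φ x ≤ v x) →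
    infLaplacian φ x₀ ≤ F x₀

/-- Real-valued subsolutions of `Δ_∞ u = F` at the points of `Ω`, with local test functions. -/
def IsSub (Ω : Set 𝔼) (F u : 𝔼 → ℝ) : Prop :=
  ∀ x₀ ∈ Ω, ∀ φ : 𝔼 → ℝ, ContDiffAt ℝ 2 φ x₀ → φ x₀ = u x₀ → (∀ᶠ x in 𝓝 x₀, u x ≤ φ x) →
    F x₀ ≤ infLaplacian φ x₀

variable {Ω U : Set (EuclideanSpace ℝ (Fin n))} {F G u v w : EuclideanSpace ℝ (Fin n) → ℝ}

lemma IsSub.neg (h : IsSub Ω F u) : IsSuper Ω (fun x => -F x) (fun x => -u x) := by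
  intro x₀ hx₀ φ hφ heq hle
  have := h x₀ hx₀ (fun x => -φ x) hφ.neg (by simp [heq])
    (hle.mono fun x hx => by linarith)
  rw [infLaplacian_neg] at this
  linarith

lemma IsSuper.neg (h : IsSuper Ω F v) : IsSub Ω (fun x => -F x) (fun x => -v x) := by
  intro x₀ hx₀ φ hφ heq hle
  have := h x₀ hx₀ (fun x => -φ x) hφ.neg (by simp [heq])
    (hle.mono fun x hx => by linarith)
  rw [infLaplacian_neg] at this
  linarith

lemma IsSuper.mono (h : IsSuper Ω F v) (hU : U ⊆ Ω) (hFG : ∀ x ∈ U, F x ≤ G x) :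
    IsSuper U G v :=
  fun x₀ hx₀ φ hφ heq hle => (h x₀ (hU hx₀) φ hφ heq hle).trans (hFG x₀ hx₀)

lemma IsSub.mono (h : IsSub Ω F u) (hU : U ⊆ Ω) (hFG : ∀ x ∈ U, G x ≤ F x) :
    IsSub U G u :=
  fun x₀ hx₀ φ hφ heq hle => (hFG x₀ hx₀).trans (h x₀ (hU hx₀) φ hφ heq hle)

lemma IsSub.const_mul (h : IsSub Ω F u) {c : ℝ} (hc : 0 < c) :
    IsSub Ω (fun x => c ^ 3 * F x) (fun x => c * u x) := by
  intro x₀ hx₀ φ hφ heq hle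
  have := h x₀ hx₀ (fun x => c⁻¹ * φ x) (contDiffAt_const.mul hφ) (by simp [heq, hc.ne'])
    (hle.mono fun x hx => by rw [inv_mul_eq_div, le_div_iff₀ hc]; linarith)
  rw [infLaplacian_const_mul] at this
  calc c ^ 3 * F x₀ ≤ c ^ 3 * (c⁻¹ ^ 3 * infLaplacian φ x₀) := by gcongr
    _ = infLaplacian φ x₀ := by field_simp

lemma IsSuper.of_contDiffAt (h : ∀ x ∈ Ω, ContDiffAt ℝ 2 w x ∧ infLaplacian w x ≤ F x) :
    IsSuper Ω F w := fun x₀ hx₀ _ hφ heq hle =>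
  (infLaplacian_le_of_touches hφ (h x₀ hx₀).1 heq hle).trans (h x₀ hx₀).2

/-- Being a supersolution at a point is a property of the germ of the function there; the
germ of a minimum of two supersolutions is allowed. -/
lemma IsSuper.of_eventually_min {x : 𝔼} (hv : IsSuper {x} F v) (hw : IsSuper {x} F w)
    (hu : ∀ᶠ y in 𝓝 x, u y = min (v y) (w y)) : IsSuper {x} F u := by
  rintro x₀ rfl φ hφ heq hle
  have hx := hu.self_of_nhds
  rcases min_choice (v x₀) (w x₀) with h | h
  · refine hv x₀ rfl φ hφ (by rw [heq, hx, h]) ?_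
    filter_upwards [hle, hu] with y h1 h2 using h1.trans (h2 ▸ min_le_left _ _)
  · refine hw x₀ rfl φ hφ (by rw [heq, hx, h]) ?_
    filter_upwards [hle, hu] with y h1 h2 using h1.trans (h2 ▸ min_le_right _ _)

lemma isSuper_iff_forall_singleton : IsSuper Ω F v ↔ ∀ x ∈ Ω, IsSuper {x} F v :=
  ⟨fun h _ hx => h.mono (singleton_subset_iff.2 hx) fun _ _ => le_rfl,
    fun h x₀ hx₀ => h x₀ hx₀ x₀ rfl⟩

/-- Strict comparison of a supersolution with a function of class `C²`. -/
lemma IsSuper.lt_of_strict {K : Set 𝔼} (hK : IsCompact K) (hU : IsOpen U) (hUK : U ⊆ K)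
    (hv : IsSuper U F v) (hlsc : LowerSemicontinuousOn v K) (hw : ContinuousOn w K)
    (hw2 : ∀ x ∈ U, ContDiffAt ℝ 2 w x ∧ F x < infLaplacian w x)
    (hbd : ∀ x ∈ K, x ∉ U → w x ≤ v x) : ∀ x ∈ U, w x < v x := by
  intro x₁ hx₁
  by_contra! hlt
  have hl : LowerSemicontinuousOn (fun x => v x + -w x) K :=
    hlsc.add hw.neg.lowerSemicontinuousOn
  obtain ⟨x₀, hx₀, hmin⟩ := hl.exists_isMinOn ⟨x₁, hUK hx₁⟩ hK
  have key : ∀ y ∈ U, (∀ x ∈ K, v y - w y ≤ v x - w x) → False := by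
    intro y hy hmin
    have h2 := hv y hy (fun x => w x + (v y - w y)) ((hw2 y hy).1.add contDiffAt_const) (by ring)
      (by
        filter_upwards [hU.mem_nhds hy] with x hx
        have := hmin x (hUK hx)
        linarith)
    rw [infLaplacian_add_const] at h2
    exact absurd h2 (not_le.2 (hw2 y hy).2)
  have hmin' : ∀ x ∈ K, v x₀ - w x₀ ≤ v x - w x := fun x hx => by
    have : v x₀ + -w x₀ ≤ v x + -w x := hmin hx
    linarith
  by_cases h0 : x₀ ∈ U
  · exact key x₀ h0 hmin'
  -- A minimum of `v - w` attained outside `U` is nonnegative, while `v - w` is nonpositive at `x₁`;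
  -- hence `x₁` is a minimizer too.
  · have h1 := hbd x₀ hx₀ h0
    exact key x₁ hx₁ fun x hx => by linarith [hmin' x hx]

/-- Strict comparison of a subsolution with a function of class `C²`. -/
lemma IsSub.lt_of_strict {K : Set 𝔼} (hK : IsCompact K) (hU : IsOpen U) (hUK : U ⊆ K)
    (hu : IsSub U F u) (hc : ContinuousOn u K) (hw : ContinuousOn w K)
    (hw2 : ∀ x ∈ U, ContDiffAt ℝ 2 w x ∧ infLaplacian w x < F x)
    (hbd : ∀ x ∈ K, x ∉ U → u x ≤ w x) : ∀ x ∈ U, u x < w x := by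
  intro x hx
  have := hu.neg.lt_of_strict hK hU hUK hc.neg.lowerSemicontinuousOn hw.neg
    (fun x hx => ⟨(hw2 x hx).1.neg, by
      change -F x < infLaplacian (fun y => -w y) x
      rw [infLaplacian_neg]; linarith [(hw2 x hx).2]⟩)
    (fun x hx hxU => by
      have := hbd x hx hxU
      simp only [Pi.neg_apply]; linarith) x hx
  simp only [Pi.neg_apply] at this
  linarith

/-! ### Relation with the extended-real-valued notions -/

lemma IsSuper.isViscositySupersolution (hΩ : IsOpen Ω) {V : 𝔼 → EReal} (h : IsSuper Ω F v)
    (hlsc : LowerSemicontinuousOn v Ω) (hV : ∀ x ∈ Ω, V x = v x) :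
    IsViscositySupersolution Ω F V where
  ne_bot x hx := by rw [hV x hx]; exact EReal.coe_ne_bot _
  lsc x hx y hy := by
    change y < V x at hy
    change ∀ᶠ z in 𝓝[Ω] x, y < V z
    rw [hV x hx] at hy
    induction y with
    | bot =>
      filter_upwards [self_mem_nhdsWithin] with z hz
      rw [hV z hz]; exact EReal.bot_lt_coe _
    | top => simp at hy
    | coe y =>
      filter_upwards [self_mem_nhdsWithin, hlsc x hx y (EReal.coe_lt_coe_iff.1 hy)] with z hz h1
      rw [hV z hz]; exact EReal.coe_lt_coe_iff.2 h1
  le_of_touches x hx φ hφ ht := by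
    refine h x hx φ (hφ.contDiffAt (hΩ.mem_nhds hx)) ?_ ?_
    · have := ht.1
      rw [hV x hx] at this
      exact (EReal.coe_eq_coe_iff.1 this).symm
    · filter_upwards [hΩ.mem_nhds hx] with y hy
      rcases eq_or_ne y x with rfl | hne
      · have := ht.1
        rw [hV y hx] at this
        exact (EReal.coe_eq_coe_iff.1 this).ge
      · have := ht.2 y hy hne
        rw [hV y hy] at this
        exact (EReal.coe_lt_coe_iff.1 this).le

/-- A local test function for a supersolution that is bounded below can be replaced by a global
one that touches strictly. -/
lemma IsViscositySupersolution.isSuper (hΩ : IsOpen Ω) {V : 𝔼 → EReal} {M : ℝ}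
    (h : IsViscositySupersolution Ω F V) (hV : ∀ x ∈ Ω, V x = v x) (hM : ∀ x ∈ Ω, M ≤ v x) :
    IsSuper Ω F v := by
  intro x₀ hx₀ φ hφ heq hle
  obtain ⟨r, hr, hball⟩ := Metric.eventually_nhds_iff_ball.1
    ((hle.and (hφ.eventually (by simp))).and (hΩ.mem_nhds hx₀))
  let χ : ContDiffBump x₀ := ⟨r / 4, r / 2, by positivity, by linarith⟩
  let q : 𝔼 → ℝ := fun x => φ x + (-1) * ‖x - x₀‖ ^ 4
  -- Away from `x₀`, on the ball both `q` and `M - 1` lie strictly below `v`, hence so does their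
  -- convex combination; off the ball only `M - 1` remains.
  let ψ : 𝔼 → ℝ := fun x => χ x * q x + (1 - χ x) * (M - 1)
  have hq : ∀ x ∈ ball x₀ r, ContDiffAt ℝ 2 q x := fun x hx =>
    (hball x hx).1.2.add (contDiffAt_const.mul (contDiff_norm_sub_pow_four x₀).contDiffAt)
  have hψ : ContDiffOn ℝ 2 ψ Ω := by
    intro x _
    refine ContDiffAt.contDiffWithinAt ?_
    by_cases hx : x ∈ ball x₀ r
    · exact (χ.contDiff.contDiffAt.mul (hq x hx)).add
        ((contDiffAt_const.sub χ.contDiff.contDiffAt).mul contDiffAt_const)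
    · have : ψ =ᶠ[𝓝 x] fun _ => M - 1 := by
        have hd : r / 2 < dist x x₀ := by
          simp only [mem_ball, not_lt] at hx; linarith
        filter_upwards [(continuousAt_id.dist continuousAt_const).eventually
          (lt_mem_nhds hd)] with y hy
        have : χ y = 0 := χ.zero_of_le_dist (by simpa [χ] using hy.le)
        simp [ψ, this]
      exact contDiffAt_const.congr_of_eventuallyEq this
  have hev : q =ᶠ[𝓝 x₀] ψ := by
    filter_upwards [χ.eventuallyEq_one] with x hx
    simp only [Pi.one_apply] at hx
    simp [ψ, hx]
  have hψx : ψ x₀ = v x₀ := by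
    rw [← hev.self_of_nhds, ← heq]; simp [q]
  have key := h.le_of_touches x₀ hx₀ ψ hψ ⟨by rw [hV x₀ hx₀, hψx], fun x hx hne => by
    rw [hV x hx, EReal.coe_lt_coe_iff]
    have h0 : 0 ≤ χ x := χ.nonneg
    have h1 : χ x ≤ 1 := χ.le_one
    have hMx := hM x hx
    by_cases hb : x ∈ ball x₀ r
    · have h2 := (hball x hb).1.1
      have h3 : 0 < ‖x - x₀‖ ^ 4 := by
        have := norm_pos_iff.2 (sub_ne_zero.2 hne)
        positivity
      have h4 : q x < v x := by simp only [q]; linarith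
      have h5 : M - 1 < v x := by linarith
      rcases h0.eq_or_lt with h0 | h0
      · simp only [ψ, ← h0]; linarith
      · simp only [ψ]; nlinarith
    · have hd : r / 2 ≤ dist x x₀ := by
        simp only [mem_ball, not_lt] at hb; linarith
      have : χ x = 0 := χ.zero_of_le_dist hd
      simp only [ψ, this]; linarith⟩
  rw [← infLaplacian_congr (hq x₀ (mem_ball_self hr)) hev, infLaplacian_add_quartic hφ] at key
  exact key

lemma IsViscositySubsolution.neg {V : 𝔼 → EReal} (h : IsViscositySubsolution Ω F V) :
    IsViscositySupersolution Ω (fun x => -F x) (fun x => -V x) where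
  ne_bot x hx := by simpa using h.ne_top x hx
  lsc x hx y hy := by
    have hy' : y < -V x := hy
    have := h.usc x hx (-y) (EReal.lt_neg_comm.1 hy')
    exact this.mono fun z hz => EReal.lt_neg_comm.1 hz
  le_of_touches x hx φ hφ ht := by
    have := h.ge_of_touches x hx (fun y => -φ y) hφ.neg ⟨by
        have h1 : -V x = (φ x : EReal) := ht.1
        rw [EReal.coe_neg, ← h1, neg_neg], fun y hy hne => by
        have h1 : (φ y : EReal) < -V y := ht.2 y hy hne
        rw [EReal.coe_neg]
        exact EReal.lt_neg_comm.1 h1⟩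
    rw [infLaplacian_neg] at this
    linarith

lemma IsViscositySupersolution.neg {V : 𝔼 → EReal} (h : IsViscositySupersolution Ω F V) :
    IsViscositySubsolution Ω (fun x => -F x) (fun x => -V x) where
  ne_top x hx := by simpa using h.ne_bot x hx
  usc x hx y hy := by
    have hy' : -V x < y := hy
    have := h.lsc x hx (-y) (EReal.neg_lt_comm.1 hy')
    exact this.mono fun z hz => EReal.neg_lt_comm.1 hz
  ge_of_touches x hx φ hφ ht := by
    have := h.le_of_touches x hx (fun y => -φ y) hφ.neg ⟨by
        have h1 : -V x = (φ x : EReal) := ht.1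
        rw [EReal.coe_neg, ← h1, neg_neg], fun y hy hne => by
        have h1 : -V y < (φ y : EReal) := ht.2 y hy hne
        rw [EReal.coe_neg]
        exact EReal.neg_lt_comm.1 h1⟩
    rw [infLaplacian_neg] at this
    linarith

end

section

/-! ### Barriers and the Lipschitz estimate -/

variable {Ω U : Set (EuclideanSpace ℝ (Fin n))} {F G g u v w : EuclideanSpace ℝ (Fin n) → ℝ}

lemma ne_of_mem_frontier (hΩ : IsOpen Ω) {ξ x : 𝔼} (hξ : ξ ∈ frontier Ω) (hx : x ∈ Ω) :
    x ≠ ξ := by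
  rintro rfl
  rw [hΩ.frontier_eq] at hξ
  exact hξ.2 hx

lemma exists_upper_barrier (hΩ : IsOpen Ω) (hb : Bornology.IsBounded Ω)
    (hF : ∃ C : ℝ, ∀ x ∈ Ω, |F x| ≤ C) (hg : ContinuousOn g (frontier Ω)) {ξ : 𝔼}
    (hξ : ξ ∈ frontier Ω) {ε : ℝ} (hε : 0 < ε) :
    ∃ B : ℝ, (∀ x ∈ Ω, infLaplacian (quadCone (g ξ + ε) B (-1) ξ) x < F x) ∧
      ∀ x ∈ frontier Ω, g x ≤ quadCone (g ξ + ε) B (-1) ξ x := by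
  obtain ⟨C, hC⟩ := hF
  have hcl : IsCompact (closure Ω) := hb.isCompact_closure
  have hfr : IsCompact (frontier Ω) := hcl.of_isClosed_subset isClosed_frontier
    frontier_subset_closure
  obtain ⟨D, hD⟩ := hcl.isBounded.exists_norm_le
  obtain ⟨S, hS⟩ := hfr.exists_bound_of_continuousOn hg
  have hD' : ∀ x ∈ closure Ω, ‖x - ξ‖ ≤ 2 * D := fun x hx => by
    have h1 := norm_sub_le x ξ
    have h2 := hD x hx
    have h3 := hD ξ (frontier_subset_closure hξ)
    linarith
  have hD0 : 0 ≤ D := (norm_nonneg _).trans (hD ξ (frontier_subset_closure hξ))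
  have hS0 : 0 ≤ S := (norm_nonneg _).trans (hS ξ hξ)
  obtain ⟨δ, hδ, hgδ⟩ := Metric.continuousWithinAt_iff.1 (hg ξ hξ) ε hε
  -- Distances to `ξ` are at most `2 * D`. The term `4 * D` absorbs both the slope loss `2 r` and
  -- the quadratic term, `|C| + 1` beats `F`, and `2 * S / δ` covers the oscillation of `g` at
  -- distance at least `δ`; nearer to `ξ` the margin `ε` suffices.
  refine ⟨4 * D + |C| + 1 + 2 * S / δ, fun x hx => ?_, fun x hx => ?_⟩
  · rw [infLaplacian_quadCone _ _ _ (ne_of_mem_frontier hΩ hξ hx)]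
    have h1 := hD' x (subset_closure hx)
    have h2 : 0 ≤ 2 * S / δ := by positivity
    have h3 : |C| + 1 ≤ 4 * D + |C| + 1 + 2 * S / δ + 2 * (-1) * ‖x - ξ‖ := by linarith
    have h4 := (abs_le.1 (hC x hx)).1
    have h5 := le_abs_self C
    have h6 := abs_nonneg C
    nlinarith
  · have h1 := hD' x (frontier_subset_closure hx)
    have h2 : 0 ≤ 2 * S / δ := by positivity
    have h6 := abs_nonneg C
    have hr := norm_nonneg (x - ξ)
    have h7 : 2 * S / δ * ‖x - ξ‖ ≤ (4 * D + |C| + 1 + 2 * S / δ) * ‖x - ξ‖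
        + -1 * ‖x - ξ‖ ^ 2 := by nlinarith
    unfold quadCone
    by_cases hxδ : dist x ξ < δ
    · have := hgδ hx hxδ
      rw [Real.dist_eq] at this
      have h8 := (abs_lt.1 this).2
      have h9 : 0 ≤ 2 * S / δ * ‖x - ξ‖ := by positivity
      linarith
    · rw [dist_eq_norm, not_lt] at hxδ
      have h8 : 2 * S ≤ 2 * S / δ * ‖x - ξ‖ := by
        rw [div_mul_eq_mul_div, le_div_iff₀ hδ]
        exact mul_le_mul_of_nonneg_left hxδ (by positivity)
      have h9 := (abs_le.1 (hS x hx)).2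
      have h10 := (abs_le.1 (hS ξ hξ)).1
      linarith

lemma exists_lower_barrier (hΩ : IsOpen Ω) (hb : Bornology.IsBounded Ω)
    (hF : ∃ C : ℝ, ∀ x ∈ Ω, |F x| ≤ C) (hg : ContinuousOn g (frontier Ω)) {ξ : 𝔼}
    (hξ : ξ ∈ frontier Ω) {ε : ℝ} (hε : 0 < ε) :
    ∃ B : ℝ, (∀ x ∈ Ω, F x < infLaplacian (quadCone (g ξ - ε) B 1 ξ) x) ∧
      ∀ x ∈ frontier Ω, quadCone (g ξ - ε) B 1 ξ x ≤ g x := by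
  obtain ⟨B, h1, h2⟩ := exists_upper_barrier (F := fun x => -F x) (g := fun x => -g x) hΩ hb
    (by simpa using hF) hg.neg hξ hε
  have he : quadCone (-g ξ + ε) B (-1) ξ = fun x => -quadCone (g ξ - ε) (-B) 1 ξ x := by
    ext x; unfold quadCone; ring
  rw [he] at h1 h2
  refine ⟨-B, fun x hx => ?_, fun x hx => ?_⟩
  · have := h1 x hx
    rw [infLaplacian_neg] at this
    linarith
  · linarith [h2 x hx]

/-- The function is compared with a steep downward cone with vertex at `y`. The constant depends
only on the bounds for `v` and `F`, so the estimate passes to infima. -/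
lemma IsSuper.sub_mul_norm_le {y : 𝔼} {R M C : ℝ} (hR : 0 < R) (hM : 0 ≤ M) (hC : 0 ≤ C)
    (hv : IsSuper (closedBall y R) F v) (hlsc : LowerSemicontinuousOn v (closedBall y R))
    (hvM : ∀ x ∈ closedBall y R, |v x| ≤ M) (hF : ∀ x ∈ closedBall y R, F x ≤ C) :
    ∀ x ∈ closedBall y R, v y - (3 * R + C + 1 + 2 * M / R) * ‖x - y‖ ≤ v x := by
  -- The slope still exceeds `C + 1` in absolute value after losing `2 * R` to the quadratic term,
  -- and `2 * M / R` brings the cone below `-M` on the sphere.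
  set L := 3 * R + C + 1 + 2 * M / R with hL
  have h2M : 0 ≤ 2 * M / R := by positivity
  have hUo : IsOpen (ball y R \ {y}) := isOpen_ball.sdiff isClosed_singleton
  have hUK : ball y R \ {y} ⊆ closedBall y R := sdiff_subset.trans ball_subset_closedBall
  have hbd : ∀ x ∈ closedBall y R, x ∉ ball y R \ {y} → quadCone (v y) (-L) 1 y x ≤ v x := by
    intro x hx hxU
    rcases eq_or_ne x y with rfl | hne
    · simp [quadCone]
    · have hr : ‖x - y‖ = R := by
        rw [← dist_eq_norm]
        refine le_antisymm hx ?_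
        by_contra! h
        exact hxU ⟨h, hne⟩
      have h1 := (abs_le.1 (hvM y (mem_closedBall_self hR.le))).2
      have h2 := (abs_le.1 (hvM x hx)).1
      have h3 : L * R = 3 * R ^ 2 + (C + 1) * R + 2 * M := by rw [hL]; field_simp; ring
      rw [quadCone, hr]
      nlinarith
  have hlt := (hv.mono hUK fun _ _ => le_rfl).lt_of_strict (isCompact_closedBall y R) hUo hUK hlsc
    (continuous_quadCone (v y) (-L) 1 y).continuousOn (fun x hx => by
      refine ⟨contDiffAt_quadCone _ _ _ hx.2, ?_⟩
      rw [infLaplacian_quadCone _ _ _ hx.2]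
      have h1 : ‖x - y‖ < R := by rw [← dist_eq_norm]; exact hx.1
      have h2 : C + 1 ≤ L - 2 * ‖x - y‖ := by linarith
      have h3 := hF x (hUK hx)
      nlinarith) hbd
  intro x hx
  have h : quadCone (v y) (-L) 1 y x ≤ v x := by
    by_cases hxU : x ∈ ball y R \ {y}
    · exact (hlt x hxU).le
    · exact hbd x hx hxU
  have : 0 ≤ ‖x - y‖ ^ 2 := by positivity
  unfold quadCone at h
  linarith

/-! ### Perron's method -/

/-- The upper class of Perron's method, truncated from above by `w`. -/
structure IsAdmissible (Ω : Set 𝔼) (F g w v : 𝔼 → ℝ) : Prop where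
  lsc : LowerSemicontinuousOn v (closure Ω)
  isSuper : IsSuper Ω F v
  le_frontier : ∀ ξ ∈ frontier Ω, g ξ ≤ v ξ
  le_bound : ∀ x ∈ closure Ω, v x ≤ w x

lemma IsSuper.min (hv : IsSuper Ω F v) (hw : IsSuper Ω F w) :
    IsSuper Ω F fun x => min (v x) (w x) :=
  isSuper_iff_forall_singleton.2 fun x hx =>
    (isSuper_iff_forall_singleton.1 hv x hx).of_eventually_min
      (isSuper_iff_forall_singleton.1 hw x hx) (Eventually.of_forall fun _ => rfl)

lemma IsAdmissible.lower_barrier_le (hΩ : IsOpen Ω) (hb : Bornology.IsBounded Ω)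
    (hv : IsAdmissible Ω F g w v) {A B C : ℝ} {ξ : 𝔼} (hξ : ξ ∈ frontier Ω)
    (h1 : ∀ x ∈ Ω, F x < infLaplacian (quadCone A B C ξ) x)
    (h2 : ∀ x ∈ frontier Ω, quadCone A B C ξ x ≤ g x) :
    ∀ x ∈ closure Ω, quadCone A B C ξ x ≤ v x := by
  have hbd : ∀ x ∈ closure Ω, x ∉ Ω → quadCone A B C ξ x ≤ v x := fun x hx hxΩ => by
    have : x ∈ frontier Ω := by rw [hΩ.frontier_eq]; exact ⟨hx, hxΩ⟩
    exact (h2 x this).trans (hv.le_frontier x this)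
  intro x hx
  by_cases hxΩ : x ∈ Ω
  · exact (hv.isSuper.lt_of_strict hb.isCompact_closure hΩ subset_closure hv.lsc
      (continuous_quadCone A B C ξ).continuousOn
      (fun x hx => ⟨contDiffAt_quadCone _ _ _ (ne_of_mem_frontier hΩ hξ hx), h1 x hx⟩)
      hbd x hxΩ).le
  · exact hbd x hx hxΩ

/-- The pointwise infimum of the truncated upper class. -/
noncomputable def perronInf (Ω : Set 𝔼) (F g w : 𝔼 → ℝ) (x : 𝔼) : ℝ :=
  ⨅ v : {v : 𝔼 → ℝ // IsAdmissible Ω F g w v}, v.1 x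

/-- The infimum of a family of supersolutions, when continuous, is a supersolution. -/
lemma isSuper_perronInf (hΩ : IsOpen Ω) (hF : ContinuousOn F Ω)
    (hne : ∃ v, IsAdmissible Ω F g w v)
    (hbdd : ∀ x ∈ closure Ω, ∃ M : ℝ, ∀ v, IsAdmissible Ω F g w v → M ≤ v x) :
    IsSuper Ω F (perronInf Ω F g w) := by
  have : Nonempty {v : 𝔼 → ℝ // IsAdmissible Ω F g w v} := ⟨⟨_, hne.choose_spec⟩⟩
  have hle : ∀ x ∈ closure Ω, ∀ v, IsAdmissible Ω F g w v → perronInf Ω F g w x ≤ v x := by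
    intro x hx v hv
    obtain ⟨M, hM⟩ := hbdd x hx
    exact ciInf_le (f := fun v : {v : 𝔼 → ℝ // IsAdmissible Ω F g w v} => v.1 x)
      ⟨M, by rintro _ ⟨v, rfl⟩; exact hM v.1 v.2⟩ ⟨v, hv⟩
  intro x₀ hx₀ φ hφ heq hφle
  by_contra! hlt
  set q : 𝔼 → ℝ := fun x => φ x + (-1) * ‖x - x₀‖ ^ 4 with hq
  have hqc : ContDiffAt ℝ 2 q x₀ :=
    hφ.add (contDiffAt_const.mul (contDiff_norm_sub_pow_four x₀).contDiffAt)
  have hqlt : F x₀ < infLaplacian q x₀ := by rwa [hq, infLaplacian_add_quartic hφ]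
  have hev := (((hF.continuousAt (hΩ.mem_nhds hx₀)).eventually_lt
    (continuousAt_infLaplacian hqc) hqlt).and (hqc.eventually (by simp))).and
    (hφle.and (hΩ.mem_nhds hx₀))
  obtain ⟨r, hr, hball⟩ := Metric.nhds_basis_closedBall.eventually_iff.1 hev
  have hr4 : perronInf Ω F g w x₀ < perronInf Ω F g w x₀ + r ^ 4 := by
    have : 0 < r ^ 4 := by positivity
    linarith
  obtain ⟨⟨v, hv⟩, hvlt⟩ := exists_lt_of_ciInf_lt hr4
  have hKΩ : closedBall x₀ r ⊆ Ω := fun x hx => (hball hx).2.2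
  have hBΩ : ball x₀ r ⊆ Ω := ball_subset_closedBall.trans hKΩ
  have hqK : ContinuousOn (fun x => q x + r ^ 4) (closedBall x₀ r) := fun x hx =>
    ((hball hx).1.2.continuousAt.add continuousAt_const).continuousWithinAt
  -- On the sphere `q + r ^ 4` equals `φ`, which is below the infimum and so below `v`; at the
  -- center it equals the infimum plus `r ^ 4`, which exceeds `v x₀` by the choice of `v`.
  have key := (hv.isSuper.mono hBΩ fun _ _ => le_rfl).lt_of_strict (isCompact_closedBall x₀ r)
    isOpen_ball ball_subset_closedBall (hv.lsc.mono (hKΩ.trans subset_closure)) hqK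
    (fun x hx => by
      have h := hball (ball_subset_closedBall hx)
      exact ⟨h.1.2.add contDiffAt_const, by rw [infLaplacian_add_const]; exact h.1.1⟩)
    (fun x hx hxU => by
      have hr' : ‖x - x₀‖ = r := by
        rw [← dist_eq_norm]; exact le_antisymm hx (not_lt.1 hxU)
      have h1 := (hball hx).2.1
      have h2 := hle x (subset_closure (hKΩ hx)) v hv
      simp only [hq, hr']
      linarith) x₀ (mem_ball_self hr)
  simp only [hq, heq, sub_self, norm_zero] at key
  simp only at hvlt
  norm_num at key
  linarith

/-- A continuous infimum of the truncated upper class is a subsolution. -/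
lemma isSub_perronInf (hΩ : IsOpen Ω) (hF : ContinuousOn F Ω)
    (hcont : ContinuousOn (perronInf Ω F g w) (closure Ω))
    (hadm : IsAdmissible Ω F g w (perronInf Ω F g w))
    (hle : ∀ x ∈ closure Ω, ∀ v, IsAdmissible Ω F g w v → perronInf Ω F g w x ≤ v x) :
    IsSub Ω F (perronInf Ω F g w) := by
  set h := perronInf Ω F g w with hdef
  intro x₀ hx₀ ψ hψ heq hψle
  by_contra! hlt
  set q : 𝔼 → ℝ := fun x => ψ x + 1 * ‖x - x₀‖ ^ 4 with hq
  have hqc : ContDiffAt ℝ 2 q x₀ :=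
    hψ.add (contDiffAt_const.mul (contDiff_norm_sub_pow_four x₀).contDiffAt)
  have hqlt : infLaplacian q x₀ < F x₀ := by rwa [hq, infLaplacian_add_quartic hψ]
  have hev := (((continuousAt_infLaplacian hqc).eventually_lt
    (hF.continuousAt (hΩ.mem_nhds hx₀)) hqlt).and (hqc.eventually (by simp))).and
    (hψle.and (hΩ.mem_nhds hx₀))
  obtain ⟨r, hr, hball⟩ := Metric.nhds_basis_ball.eventually_iff.1 hev
  -- With this `η`, `h ≤ q - η` on the part of the ball at distance at least `r / 2` from `x₀`, so
  -- the lowered function coincides with `h` there and the gluing is continuous.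
  set η := (r / 2) ^ 4 with hη
  have hη0 : 0 < η := by positivity
  classical
  let v : 𝔼 → ℝ := fun x => if x ∈ ball x₀ r then min (h x) (q x + -η) else h x
  have hvle : ∀ x, v x ≤ h x := fun x => by
    by_cases hx : x ∈ ball x₀ r
    · simp only [v, if_pos hx, min_le_left]
    · simp only [v, if_neg hx, le_refl]
  have hin : ∀ x ∈ ball x₀ r, ∀ᶠ y in 𝓝 x, v y = min (h y) (q y + -η) := fun x hx => by
    filter_upwards [isOpen_ball.mem_nhds hx] with y hy
    exact if_pos hy
  have hout' : ∀ y, r / 2 ≤ dist y x₀ → v y = h y := fun y hy => by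
    by_cases hyr : y ∈ ball x₀ r
    · have h1 := (hball hyr).2.1
      have h2 : η ≤ ‖y - x₀‖ ^ 4 := by
        rw [hη, ← dist_eq_norm]; gcongr
      simp only [v, if_pos hyr]
      exact min_eq_left (by simp only [hq]; linarith)
    · exact if_neg hyr
  have hout : ∀ x, x ∉ ball x₀ r → ∀ᶠ y in 𝓝 x, v y = h y := fun x hx => by
    have hd : r / 2 < dist x x₀ := by
      simp only [mem_ball, not_lt] at hx; linarith
    filter_upwards [(continuousAt_id.dist continuousAt_const).eventually
      (lt_mem_nhds hd)] with y hy using hout' y (le_of_lt hy)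
  have hv : IsAdmissible Ω F g w v := by
    refine ⟨ContinuousOn.lowerSemicontinuousOn fun x hx => ?_,
      isSuper_iff_forall_singleton.2 fun x hx => ?_, fun ξ hξ => ?_,
      fun x hx => (hvle x).trans (hadm.le_bound x hx)⟩
    · by_cases hxr : x ∈ ball x₀ r
      · have hm : ContinuousWithinAt (fun y => min (h y) (q y + -η)) (closure Ω) x :=
          (hcont x hx).min ((hball hxr).1.2.continuousAt.add
            continuousAt_const).continuousWithinAt
        exact hm.congr_of_eventuallyEq (eventually_nhdsWithin_of_eventually_nhds (hin x hxr))
          (hin x hxr).self_of_nhds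
      · exact (hcont x hx).congr_of_eventuallyEq
          (eventually_nhdsWithin_of_eventually_nhds (hout x hxr)) (hout x hxr).self_of_nhds
    · have hs := isSuper_iff_forall_singleton.1 hadm.isSuper x hx
      by_cases hxr : x ∈ ball x₀ r
      · refine hs.of_eventually_min (IsSuper.of_contDiffAt (w := fun y => q y + -η) ?_)
          (hin x hxr)
        rintro _ rfl
        refine ⟨(hball hxr).1.2.add contDiffAt_const, ?_⟩
        rw [infLaplacian_add_const]
        exact (hball hxr).1.1.le
      · exact hs.of_eventually_min hs ((hout x hxr).mono fun y hy => by rw [hy, min_self])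
    · have : ξ ∉ ball x₀ r := fun hmem =>
        ne_of_mem_frontier hΩ hξ (hball hmem).2.2 rfl
      rw [(hout ξ this).self_of_nhds]
      exact hadm.le_frontier ξ hξ
  have h1 := hle x₀ (subset_closure hx₀) v hv
  have h2 : v x₀ ≤ q x₀ + -η := by
    rw [(hin x₀ (mem_ball_self hr)).self_of_nhds]; exact min_le_right _ _
  have h3 : q x₀ = h x₀ := by simp [hq, heq]
  linarith

lemma nonempty_frontier_of_isBounded (hn : 1 ≤ n) (hne : Ω.Nonempty)
    (hb : Bornology.IsBounded Ω) : (frontier Ω).Nonempty := by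
  have : Nonempty (Fin n) := ⟨⟨0, hn⟩⟩
  by_contra! h
  rcases isClopen_iff.1 (isClopen_iff_frontier_eq_empty.2 h) with h | h
  · exact hne.ne_empty h
  · exact NormedSpace.unbounded_univ ℝ 𝔼 (h ▸ hb)

/-- Perron's method: there is a solution with boundary values `g` lying below every
supersolution that is at least `g` on the boundary. -/
theorem exists_minimal_solution (hn : 1 ≤ n) (hΩ : IsOpen Ω) (hne : Ω.Nonempty)
    (hb : Bornology.IsBounded Ω) (hF : ContinuousOn F Ω) (hFb : ∃ C : ℝ, ∀ x ∈ Ω, |F x| ≤ C)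
    (hg : ContinuousOn g (frontier Ω)) :
    ∃ h : 𝔼 → ℝ, ContinuousOn h (closure Ω) ∧ IsSuper Ω F h ∧ IsSub Ω F h ∧
      (∀ ξ ∈ frontier Ω, h ξ = g ξ) ∧
      ∀ v, LowerSemicontinuousOn v (closure Ω) → IsSuper Ω F v → (∀ ξ ∈ frontier Ω, g ξ ≤ v ξ) →
        ∀ x ∈ closure Ω, h x ≤ v x := by
  obtain ⟨ξ₀, hξ₀⟩ := nonempty_frontier_of_isBounded hn hne hb
  obtain ⟨B₀, hw1, hw2⟩ := exists_upper_barrier hΩ hb hFb hg hξ₀ one_pos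
  obtain ⟨B₁, hl1, hl2⟩ := exists_lower_barrier hΩ hb hFb hg hξ₀ one_pos
  set w := quadCone (g ξ₀ + 1) B₀ (-1) ξ₀ with hw
  have hcone : ∀ {A B C : ℝ} {ξ : 𝔼}, ξ ∈ frontier Ω →
      (∀ x ∈ Ω, infLaplacian (quadCone A B C ξ) x < F x) → IsSuper Ω F (quadCone A B C ξ) :=
    fun hξ h => IsSuper.of_contDiffAt fun x hx =>
      ⟨contDiffAt_quadCone _ _ _ (ne_of_mem_frontier hΩ hξ hx), (h x hx).le⟩
  have hwc : Continuous w := continuous_quadCone _ _ _ _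
  have hwadm : IsAdmissible Ω F g w w :=
    ⟨hwc.continuousOn.lowerSemicontinuousOn, hcone hξ₀ hw1, hw2, fun _ _ => le_rfl⟩
  -- Truncation by `w` makes any competitor admissible, so minimality in the truncated class is
  -- minimality among all supersolutions.
  have hminadm : ∀ v, LowerSemicontinuousOn v (closure Ω) → IsSuper Ω F v →
      (∀ ξ ∈ frontier Ω, g ξ ≤ v ξ) → IsAdmissible Ω F g w fun x => min (v x) (w x) :=
    fun v h1 h2 h3 => ⟨h1.inf hwadm.lsc, h2.min hwadm.isSuper,
      fun ξ hξ => le_min (h3 ξ hξ) (hw2 ξ hξ), fun x _ => min_le_right _ _⟩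
  have : Nonempty {v : 𝔼 → ℝ // IsAdmissible Ω F g w v} := ⟨⟨_, hwadm⟩⟩
  have hlow : ∀ v, IsAdmissible Ω F g w v → ∀ x ∈ closure Ω,
      quadCone (g ξ₀ - 1) B₁ 1 ξ₀ x ≤ v x := fun v hv =>
    hv.lower_barrier_le hΩ hb hξ₀ hl1 hl2
  set h := perronInf Ω F g w with hdef
  have hle : ∀ x ∈ closure Ω, ∀ v, IsAdmissible Ω F g w v → h x ≤ v x := fun x hx v hv =>
    ciInf_le (f := fun v : {v : 𝔼 → ℝ // IsAdmissible Ω F g w v} => v.1 x)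
      ⟨_, by rintro _ ⟨v, rfl⟩; exact hlow v.1 v.2 x hx⟩ ⟨v, hv⟩
  have hge : ∀ (x : 𝔼) (a : ℝ), (∀ v, IsAdmissible Ω F g w v → a ≤ v x) → a ≤ h x :=
    fun x a ha => le_ciInf fun v => ha v.1 v.2
  have hup : ∀ ξ ∈ frontier Ω, ∀ ε > 0, ∃ B, ∀ x ∈ closure Ω,
      h x ≤ quadCone (g ξ + ε) B (-1) ξ x := fun ξ hξ ε hε => by
    obtain ⟨B, h1, h2⟩ := exists_upper_barrier hΩ hb hFb hg hξ hε
    exact ⟨B, fun x hx => (hle x hx _ (hminadm _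
      (continuous_quadCone _ _ _ _).continuousOn.lowerSemicontinuousOn (hcone hξ h1) h2)).trans
      (min_le_left _ _)⟩
  have hdown : ∀ ξ ∈ frontier Ω, ∀ ε > 0, ∃ B, ∀ x ∈ closure Ω,
      quadCone (g ξ - ε) B 1 ξ x ≤ h x := fun ξ hξ ε hε => by
    obtain ⟨B, h1, h2⟩ := exists_lower_barrier hΩ hb hFb hg hξ hε
    exact ⟨B, fun x hx => hge x _ fun v hv => hv.lower_barrier_le hΩ hb hξ h1 h2 x hx⟩
  have hval : ∀ ξ ∈ frontier Ω, h ξ = g ξ := fun ξ hξ => by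
    refine le_antisymm (le_of_forall_pos_le_add fun ε hε => ?_)
      (le_of_forall_pos_le_add fun ε hε => ?_)
    · obtain ⟨B, hB⟩ := hup ξ hξ ε hε
      simpa [quadCone] using hB ξ (frontier_subset_closure hξ)
    · obtain ⟨B, hB⟩ := hdown ξ hξ ε hε
      simpa [quadCone] using hB ξ (frontier_subset_closure hξ)
  have hcont : ContinuousOn h (closure Ω) := by
    intro x hx
    by_cases hxΩ : x ∈ Ω
    · refine ContinuousAt.continuousWithinAt ?_
      obtain ⟨M₁, hM₁⟩ := hb.isCompact_closure.exists_bound_of_continuousOn hwc.continuousOn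
      obtain ⟨M₂, hM₂⟩ := hb.isCompact_closure.exists_bound_of_continuousOn
        (continuous_quadCone (g ξ₀ - 1) B₁ 1 ξ₀).continuousOn
      obtain ⟨C, hC⟩ := hFb
      obtain ⟨R, hR, hball⟩ := Metric.nhds_basis_closedBall.mem_iff.1 (hΩ.mem_nhds hxΩ)
      have hM0 : 0 ≤ max M₁ M₂ := (norm_nonneg _).trans ((hM₁ x hx).trans (le_max_left _ _))
      have hC0 : 0 ≤ C := (abs_nonneg _).trans (hC x hxΩ)
      -- The one-sided estimate holds with one constant for all admissible functions; exchanging the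
      -- two points later gives the Lipschitz bound.
      have hlip : ∀ y ∈ closedBall x (R / 2), ∀ z ∈ closedBall y (R / 2),
          h y - (3 * (R / 2) + C + 1 + 2 * max M₁ M₂ / (R / 2)) * ‖z - y‖ ≤ h z := by
        intro y hy z hz
        have hsub : closedBall y (R / 2) ⊆ Ω := fun a ha => hball (by
          have h1 := dist_triangle a y x
          simp only [mem_closedBall] at hy ha ⊢
          linarith)
        refine hge z _ fun v hv => ?_
        have h1 := hle y (subset_closure (hsub (mem_closedBall_self (by positivity)))) v hv
        have h2 := (hv.isSuper.mono hsub fun _ _ => le_rfl).sub_mul_norm_le (half_pos hR) hM0 hC0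
          (hv.lsc.mono (hsub.trans subset_closure)) (fun a ha => by
            have ha' := subset_closure (hsub ha)
            have h3 := hv.le_bound a ha'
            have h4 := hlow v hv a ha'
            have h5 := (abs_le.1 (hM₁ a ha')).2
            have h6 := (abs_le.1 (hM₂ a ha')).1
            exact abs_le.2 ⟨by linarith [le_max_right M₁ M₂], by linarith [le_max_left M₁ M₂]⟩)
          (fun a ha => (le_abs_self _).trans (hC a (hsub ha))) z hz
        linarith
      refine continuousAt_of_locally_lipschitz (half_pos hR)
        (3 * (R / 2) + C + 1 + 2 * max M₁ M₂ / (R / 2)) fun y hy => ?_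
      have h1 := hlip x (mem_closedBall_self (by positivity)) y hy.le
      have h2 := hlip y hy.le x (by rw [mem_closedBall']; exact hy.le)
      rw [Real.dist_eq, dist_eq_norm, abs_le]
      rw [norm_sub_rev x y] at h2
      constructor <;> linarith
    · have hξ : x ∈ frontier Ω := by rw [hΩ.frontier_eq]; exact ⟨hx, hxΩ⟩
      rw [ContinuousWithinAt, hval x hξ]
      refine tendsto_order.2 ⟨fun a ha => ?_, fun a ha => ?_⟩
      · obtain ⟨B, hB⟩ := hdown x hξ ((g x - a) / 2) (by linarith)
        have hc := (continuous_quadCone (g x - (g x - a) / 2) B 1 x).continuousAt (x := x)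
        have : a < quadCone (g x - (g x - a) / 2) B 1 x x := by simp [quadCone]; linarith
        filter_upwards [self_mem_nhdsWithin,
          eventually_nhdsWithin_of_eventually_nhds (hc.eventually (lt_mem_nhds this))]
          with y hy h1 using h1.trans_le (hB y hy)
      · obtain ⟨B, hB⟩ := hup x hξ ((a - g x) / 2) (by linarith)
        have hc := (continuous_quadCone (g x + (a - g x) / 2) B (-1) x).continuousAt (x := x)
        have : quadCone (g x + (a - g x) / 2) B (-1) x x < a := by simp [quadCone]; linarith
        filter_upwards [self_mem_nhdsWithin,
          eventually_nhdsWithin_of_eventually_nhds (hc.eventually (gt_mem_nhds this))]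
          with y hy h1 using (hB y hy).trans_lt h1
  have hsup : IsSuper Ω F h := isSuper_perronInf hΩ hF ⟨w, hwadm⟩
    fun x hx => ⟨_, fun v hv => hlow v hv x hx⟩
  have hadm : IsAdmissible Ω F g w h := ⟨hcont.lowerSemicontinuousOn, hsup,
    fun ξ hξ => (hval ξ hξ).ge, fun x hx => hle x hx w hwadm⟩
  exact ⟨h, hcont, hsup, isSub_perronInf hΩ hF hcont hadm hle, hval, fun v h1 h2 h3 x hx =>
    (hle x hx _ (hminadm v h1 h2 h3)).trans (min_le_left _ _)⟩

end

section

/-! ### Maxima over balls -/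

variable {Ω U : Set (EuclideanSpace ℝ (Fin n))} {F F₁ F₂ u v : EuclideanSpace ℝ (Fin n) → ℝ}
  {z : EuclideanSpace ℝ (Fin n)}

/-- The maximum of `u` over the closed ball of radius `s` about `z`. -/
noncomputable def ballMax (u : 𝔼 → ℝ) (z : 𝔼) (s : ℝ) : ℝ := sSup (u '' closedBall z s)

lemma le_ballMax {s : ℝ} (hu : ContinuousOn u (closedBall z s)) {x : 𝔼}
    (hx : x ∈ closedBall z s) : u x ≤ ballMax u z s :=
  le_csSup ((isCompact_closedBall z s).bddAbove_image hu) (mem_image_of_mem u hx)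

lemma exists_eq_ballMax {s : ℝ} (hs : 0 ≤ s) (hu : ContinuousOn u (closedBall z s)) :
    ∃ x ∈ closedBall z s, u x = ballMax u z s :=
  ((isCompact_closedBall z s).image_of_continuousOn hu).sSup_mem
    ((nonempty_closedBall.2 hs).image u)

lemma ballMax_le {s a : ℝ} (hs : 0 ≤ s) (h : ∀ x ∈ closedBall z s, u x ≤ a) :
    ballMax u z s ≤ a :=
  csSup_le ((nonempty_closedBall.2 hs).image u) (by rintro _ ⟨x, hx, rfl⟩; exact h x hx)

/-- Comparison with cones: for subsolutions with nonnegative right-hand side the maximum over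
balls is a convex function of the radius. -/
lemma IsSub.ballMax_le_chord {T s : ℝ} (hT : 0 < T) (hs : 0 ≤ s) (hsT : s ≤ T)
    (hu : IsSub (closedBall z T) F u) (hc : ContinuousOn u (closedBall z T))
    (hF : ∀ x ∈ closedBall z T, 0 ≤ F x) :
    ballMax u z s ≤ u z + (ballMax u z T - u z) / T * s := by
  set B := (ballMax u z T - u z) / T with hB
  have hBT : B * T = ballMax u z T - u z := by rw [hB]; field_simp
  have hz : u z ≤ ballMax u z T := le_ballMax hc (mem_closedBall_self hT.le)
  have hB0 : 0 ≤ B := div_nonneg (by linarith) hT.le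
  -- With zero slope the perturbed cone below would have a critical sphere; here `u` is simply
  -- bounded by its value at the center.
  rcases hB0.eq_or_lt with h0 | hBpos
  · refine ballMax_le hs fun x hx => ?_
    have := le_ballMax hc (closedBall_subset_closedBall hsT hx)
    rw [← h0] at hBT ⊢
    linarith
  refine le_of_forall_pos_le_add fun δ hδ => ballMax_le hs fun x hx => ?_
  -- The cone of slope `B` is bent to `(B + ε T) r - ε r ^ 2`: same value at `r = T`, slope still
  -- positive, strictly negative `∞`-Laplacian, and an excess of at most `δ`.
  obtain ⟨ε, hε, hεB, hεδ⟩ : ∃ ε > 0, ε * T < B ∧ ε * T ^ 2 ≤ δ := by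
    refine ⟨min (B / (2 * T)) (δ / T ^ 2), by positivity, ?_, ?_⟩
    · calc min (B / (2 * T)) (δ / T ^ 2) * T ≤ B / (2 * T) * T := by gcongr; exact min_le_left _ _
        _ = B / 2 := by field_simp
        _ < B := by linarith
    · calc min (B / (2 * T)) (δ / T ^ 2) * T ^ 2 ≤ δ / T ^ 2 * T ^ 2 := by
            gcongr; exact min_le_right _ _
        _ = δ := by field_simp
  have hUo : IsOpen (ball z T \ {z}) := isOpen_ball.sdiff isClosed_singleton
  have hUK : ball z T \ {z} ⊆ closedBall z T := sdiff_subset.trans ball_subset_closedBall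
  have hbd : ∀ y ∈ closedBall z T, y ∉ ball z T \ {z} →
      u y ≤ quadCone (u z) (B + ε * T) (-ε) z y := by
    intro y hy hyU
    rcases eq_or_ne y z with rfl | hne
    · simp [quadCone]
    · have hr : ‖y - z‖ = T := by
        rw [← dist_eq_norm]
        refine le_antisymm hy ?_
        by_contra! h
        exact hyU ⟨h, hne⟩
      have := le_ballMax hc hy
      rw [quadCone, hr]
      nlinarith
  have hlt := (hu.mono hUK fun _ _ => le_rfl).lt_of_strict (isCompact_closedBall z T) hUo hUK hc
    (continuous_quadCone (u z) (B + ε * T) (-ε) z).continuousOn (fun y hy => by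
      refine ⟨contDiffAt_quadCone _ _ _ hy.2, ?_⟩
      rw [infLaplacian_quadCone _ _ _ hy.2]
      have h1 : ‖y - z‖ < T := by rw [← dist_eq_norm]; exact hy.1
      have h2 : 0 < B + ε * T + 2 * -ε * ‖y - z‖ := by nlinarith
      have h3 := hF y (hUK hy)
      have h4 := pow_pos h2 2
      nlinarith) hbd
  have hxT : x ∈ closedBall z T := closedBall_subset_closedBall hsT hx
  have h : u x ≤ quadCone (u z) (B + ε * T) (-ε) z x := by
    by_cases hxU : x ∈ ball z T \ {z}
    · exact (hlt x hxU).le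
    · exact hbd x hxT hxU
  have hr : ‖x - z‖ ≤ s := by rw [← dist_eq_norm]; exact hx
  have hr0 := norm_nonneg (x - z)
  unfold quadCone at h
  have h5 : B * ‖x - z‖ ≤ B * s := by gcongr
  have h6 : ε * T * ‖x - z‖ ≤ ε * T ^ 2 := by
    rw [pow_two, ← mul_assoc]
    exact mul_le_mul_of_nonneg_left (hr.trans hsT) (by positivity)
  nlinarith [mul_nonneg hε.le (sq_nonneg ‖x - z‖)]

lemma IsSub.lt_quadCone_of_annulus {s₁ s₂ A B C : ℝ} (hs : 0 < s₁)
    (hu : IsSub (closedBall z s₂) F u) (hc : ContinuousOn u (closedBall z s₂))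
    (hΛ : ∀ x, s₁ < ‖x - z‖ → ‖x - z‖ < s₂ → 2 * C * (B + 2 * C * ‖x - z‖) ^ 2 < F x)
    (h₁ : ∀ x, ‖x - z‖ = s₁ → u x ≤ A + B * s₁ + C * s₁ ^ 2)
    (h₂ : ∀ x, ‖x - z‖ = s₂ → u x ≤ A + B * s₂ + C * s₂ ^ 2) :
    ∀ x, s₁ < ‖x - z‖ → ‖x - z‖ < s₂ → u x < quadCone A B C z x := by
  have hnc : Continuous fun x : 𝔼 => ‖x - z‖ := by fun_prop
  set U : Set 𝔼 := {x | s₁ < ‖x - z‖ ∧ ‖x - z‖ < s₂} with hU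
  set K : Set 𝔼 := {x | s₁ ≤ ‖x - z‖} ∩ closedBall z s₂ with hK
  have hUo : IsOpen U := (isOpen_lt continuous_const hnc).inter (isOpen_lt hnc continuous_const)
  have hKc : IsCompact K :=
    (isCompact_closedBall z s₂).inter_left (isClosed_le continuous_const hnc)
  have hUB : U ⊆ closedBall z s₂ := fun x hx => by
    rw [mem_closedBall, dist_eq_norm]; exact hx.2.le
  intro x hx₁ hx₂
  refine (hu.mono hUB fun _ _ => le_rfl).lt_of_strict hKc hUo (fun x hx => ⟨hx.1.le, hUB hx⟩)
    (hc.mono inter_subset_right) (continuous_quadCone A B C z).continuousOn (fun y hy => ?_)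
    (fun y hy hyU => ?_) x ⟨hx₁, hx₂⟩
  · have hne : y ≠ z := by
      rintro rfl
      have := hy.1
      simp at this
      linarith
    exact ⟨contDiffAt_quadCone _ _ _ hne, by
      rw [infLaplacian_quadCone _ _ _ hne]; exact hΛ y hy.1 hy.2⟩
  · have hy2 : ‖y - z‖ ≤ s₂ := by rw [← dist_eq_norm]; exact hy.2
    unfold quadCone
    rcases (show s₁ ≤ ‖y - z‖ from hy.1).eq_or_lt with h | h
    · rw [← h]; exact h₁ y h.symm
    · rcases hy2.eq_or_lt with h' | h'
      · rw [h']; exact h₂ y h'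
      · exact absurd ⟨h, h'⟩ hyU

/-- The maxima of a subsolution over three concentric balls cannot lie on or below a parabola
whose cone is a strict supersolution. -/
lemma IsSub.false_of_ballMax_le {c a b ρ t : ℝ} (ht : 0 < t) (htρ : t < ρ)
    (hu : IsSub (closedBall z (ρ + t)) (fun _ => c) u)
    (hc : ContinuousOn u (closedBall z (ρ + t)))
    (hΛ : ∀ s, ρ - t < s → s < ρ + t → b * (a + b * (s - ρ)) ^ 2 < c) (hab : |b| * t ≤ 2 * a)
    (h₀ : ballMax u z (ρ - t) < ballMax u z ρ)
    (h₁ : ballMax u z (ρ - t) ≤ ballMax u z ρ - a * t + b / 2 * t ^ 2)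
    (h₂ : ballMax u z (ρ + t) ≤ ballMax u z ρ + a * t + b / 2 * t ^ 2) : False := by
  have hcs : ∀ {s}, s ≤ ρ + t → ContinuousOn u (closedBall z s) := fun h =>
    hc.mono (closedBall_subset_closedBall h)
  obtain ⟨x, hx, hxm⟩ := exists_eq_ballMax (u := u) (z := z) (s := ρ) (by linarith)
    (hcs (by linarith))
  have hmem : ∀ {y : 𝔼} {s : ℝ}, ‖y - z‖ ≤ s → y ∈ closedBall z s := fun h => by
    rw [mem_closedBall, dist_eq_norm]; exact h
  have hx₂ : ‖x - z‖ ≤ ρ := by rw [← dist_eq_norm]; exact hx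
  have hx₁ : ρ - t < ‖x - z‖ := by
    by_contra! h
    have := le_ballMax (hcs (by linarith)) (hmem h)
    linarith
  -- The coefficients expand the parabola `m ρ + a (s - ρ) + b / 2 (s - ρ) ^ 2` in powers of `s`,
  -- where `m` is the ball maximum.
  have key := hu.lt_quadCone_of_annulus (s₁ := ρ - t)
    (A := ballMax u z ρ - a * ρ + b / 2 * ρ ^ 2) (B := a - b * ρ) (C := b / 2)
    (by linarith) hc
    (fun y hy₁ hy₂ => by
      have := hΛ _ hy₁ hy₂
      calc 2 * (b / 2) * (a - b * ρ + 2 * (b / 2) * ‖y - z‖) ^ 2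
          = b * (a + b * (‖y - z‖ - ρ)) ^ 2 := by ring
        _ < c := this)
    (fun y hy => by
      have := le_ballMax (hcs (by linarith)) (hmem hy.le)
      calc u y ≤ _ := this
        _ ≤ _ := h₁
        _ = _ := by ring)
    (fun y hy => by
      have := le_ballMax (hcs le_rfl) (hmem hy.le)
      calc u y ≤ _ := this
        _ ≤ _ := h₂
        _ = _ := by ring) x hx₁ (by linarith)
  rw [hxm, quadCone] at key
  -- The maximizer may lie inside the ball of radius `ρ`; this bound makes the parabola at `‖x - z‖`
  -- at most its value at `ρ`, against the strict inequality `key`.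
  have h3 : b * (ρ - ‖x - z‖) ≤ 2 * a := by
    calc b * (ρ - ‖x - z‖) ≤ |b| * (ρ - ‖x - z‖) := by
          exact mul_le_mul_of_nonneg_right (le_abs_self b) (by linarith)
      _ ≤ |b| * t := by gcongr; linarith
      _ ≤ 2 * a := hab
  nlinarith [mul_nonneg (sub_nonneg.2 h3) (sub_nonneg.2 hx₂)]

/-- Points of concentric balls of radii `s` and `s'` are within `s + s'` of each other, so their
pair obeys the constraint. -/
lemma ballMax_neg_add_le {R M s s' : ℝ} (hs : 0 ≤ s) (hs' : 0 ≤ s') (hR : s + s' = R)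
    (hu : ContinuousOn u (closedBall z R)) (hv : ContinuousOn v (closedBall z R))
    (hmax : ∀ x ∈ closedBall z R, ∀ y ∈ closedBall z R, dist x y ≤ R → u x - v y ≤ M) :
    ballMax u z s + ballMax (fun x => -v x) z s' ≤ M := by
  have h1 : closedBall z s ⊆ closedBall z R := closedBall_subset_closedBall (by linarith)
  have h2 : closedBall z s' ⊆ closedBall z R := closedBall_subset_closedBall (by linarith)
  obtain ⟨x, hx, hxm⟩ := exists_eq_ballMax hs (hu.mono h1)
  obtain ⟨y, hy, hym⟩ := exists_eq_ballMax (u := fun x => -v x) hs' (hv.neg.mono h2)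
  have := hmax x (h1 hx) y (h2 hy) (by
    have h3 := dist_triangle_right x y z
    simp only [mem_closedBall] at hx hy
    linarith)
  linarith

/-- If the right-hand sides are strictly ordered, `u x - v y` has no interior maximum under the
constraint `dist x y ≤ R`. -/
lemma false_of_max_dist_le {R f₁ f₂ : ℝ} (hR : 0 < R)
    (hu : IsSub (closedBall z R) (fun _ => f₁) u) (hv : IsSuper (closedBall z R) (fun _ => f₂) v)
    (huc : ContinuousOn u (closedBall z R)) (hvc : ContinuousOn v (closedBall z R))
    (hf : f₂ < f₁) (hf₁ : 0 < f₁) {x₀ y₀ : 𝔼} (hx₀ : x₀ ∈ closedBall z (R / 2))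
    (hy₀ : y₀ ∈ closedBall z (R / 2))
    (hmax : ∀ x ∈ closedBall z R, ∀ y ∈ closedBall z R, dist x y ≤ R →
      u x - v y ≤ u x₀ - v y₀) : False := by
  -- Raising a negative `f₂` to `0` keeps `v` a supersolution and keeps `f₂ < f₁`, because `f₁ > 0`.
  wlog hf₂ : 0 ≤ f₂ generalizing f₂
  · exact this (f₂ := max f₂ 0) (hv.mono subset_rfl fun _ _ => le_max_left _ _)
      (max_lt hf hf₁) (le_max_right _ _)
  set ρ := R / 2 with hρ
  have hρ0 : 0 < ρ := by positivity
  have hRρ : R = ρ + ρ := by rw [hρ]; ring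
  have hk : IsSub (closedBall z R) (fun _ => -f₂) (fun x => -v x) := hv.neg
  have hsub : ∀ {s}, s ≤ R → closedBall z s ⊆ closedBall z R := closedBall_subset_closedBall
  have hρR : ρ ≤ R := by linarith
  set m := ballMax u z
  set k := ballMax (fun x => -v x) z
  have hpair : ∀ s s', 0 ≤ s → 0 ≤ s' → s + s' = R → m s + k s' ≤ m ρ + k ρ := by
    intro s s' hs hs' hss
    have h1 := ballMax_neg_add_le hs hs' hss huc hvc hmax
    have h2 := le_ballMax (huc.mono (hsub hρR)) hx₀
    have h3 := le_ballMax (u := fun x => -v x) (hvc.neg.mono (hsub hρR)) hy₀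
    linarith
  -- Otherwise a constant touches `u` from above at `z`, forcing `f₁ ≤ 0`.
  have hpos : u z < m ρ := by
    by_contra! hle
    have := hu z (mem_closedBall_self hR.le) (fun _ => u z) contDiffAt_const rfl (by
      filter_upwards [closedBall_mem_nhds z hρ0] with x hx
      exact (le_ballMax (huc.mono (hsub hρR)) hx).trans hle)
    have h0 : infLaplacian (fun _ : 𝔼 => u z) z = 0 := by
      simp [infLaplacian, partialDeriv]
    rw [h0] at this
    linarith
  set α := (m ρ - u z) / ρ with hα
  have hα0 : 0 < α := div_pos (by linarith) hρ0
  have hchord : ∀ s, 0 ≤ s → s ≤ ρ → m s ≤ u z + α * s := fun s hs hsρ =>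
    (hu.mono (hsub hρR) fun _ _ => le_rfl).ballMax_le_chord hρ0 hs hsρ (huc.mono (hsub hρR))
      fun _ _ => hf₁.le
  set f := (f₁ + f₂) / 2 with hfdef
  have hf0 : 0 < f := by linarith
  -- The step `t` is measured against `α`, not against the difference quotient `a₁`, which itself
  -- depends on `t`; the chord inequality gives `α ≤ a₁`.
  obtain ⟨t, ⟨ht1, ht2, ht3, htρ⟩, ht⟩ : ∃ t : ℝ, (f * (1 + 2 * f * t / α ^ 3) ^ 2 < f₁ ∧
      f₂ < f * (1 - 2 * f * t / α ^ 3) ^ 2 ∧ 2 * f * t / α ^ 3 < 1 ∧ t < ρ) ∧ 0 < t := by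
    have c1 : ContinuousAt (fun t : ℝ => f * (1 + 2 * f * t / α ^ 3) ^ 2) 0 := by fun_prop
    have c2 : ContinuousAt (fun t : ℝ => f * (1 - 2 * f * t / α ^ 3) ^ 2) 0 := by fun_prop
    have c3 : ContinuousAt (fun t : ℝ => 2 * f * t / α ^ 3) 0 := by fun_prop
    have e1 := c1.eventually_lt (continuousAt_const (y := f₁)) (by simp; linarith)
    have e2 := (continuousAt_const (y := f₂)).eventually_lt c2 (by simp; linarith)
    have e3 := c3.eventually_lt (continuousAt_const (y := (1 : ℝ))) (by simp)
    have e := (e1.and (e2.and (e3.and (gt_mem_nhds hρ0))))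
    exact ((e.filter_mono nhdsWithin_le_nhds).and
      (self_mem_nhdsWithin : Ioi (0 : ℝ) ∈ 𝓝[>] 0)).exists
  set θ := 2 * f * t / α ^ 3 with hθ
  have hθ0 : 0 ≤ θ := by positivity
  set a₁ := (m ρ - m (ρ - t)) / t with ha₁
  have ha₁t : a₁ * t = m ρ - m (ρ - t) := by rw [ha₁]; field_simp
  have hαa : α ≤ a₁ := by
    rw [ha₁, le_div_iff₀ ht]
    have h1 := hchord (ρ - t) (by linarith) (by linarith)
    have h2 : α * ρ = m ρ - u z := by rw [hα]; field_simp
    linarith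
  have ha0 : 0 < a₁ := hα0.trans_le hαa
  -- This curvature makes slope squared times curvature equal to `f`, strictly between `f₂` and
  -- `f₁`; by the choice of `t` the variation of the slope over the annulus does not spoil this.
  set b := f / a₁ ^ 2 with hb
  have hb0 : 0 < b := by positivity
  have hba : b * a₁ ^ 2 = f := by rw [hb]; field_simp
  have hbt : 2 * (b * t) ≤ a₁ * θ := by
    have : 2 * (b * t) = a₁ * (2 * f * t / a₁ ^ 3) := by rw [hb]; field_simp
    rw [this, hθ]
    gcongr
  have hbt0 : 0 < b * t := by positivity
  -- With this slope at `ρ` the parabola of curvature `b` passes exactly through `m (ρ - t)`; the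
  -- subsolution `u` must then exceed it at `ρ + t`.
  set a := a₁ + b * t / 2 with ha
  have hmgt : m ρ + a * t + b / 2 * t ^ 2 < m (ρ + t) := by
    by_contra! hle
    refine (hu.mono (hsub (s := ρ + t) (by linarith)) fun _ _ => le_rfl).false_of_ballMax_le
      ht htρ (huc.mono (hsub (by linarith))) (a := a) (b := b) (fun s hs₁ hs₂ => ?_) ?_ ?_ ?_ hle
    · have h1 : b * (s - ρ) ≤ b * t := by gcongr; linarith
      have h2 : -(b * t) ≤ b * (s - ρ) := by nlinarith
      have h3 : a + b * (s - ρ) ≤ a₁ * (1 + θ) := by linarith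
      have h4 : 0 ≤ a + b * (s - ρ) := by nlinarith
      calc b * (a + b * (s - ρ)) ^ 2 ≤ b * (a₁ * (1 + θ)) ^ 2 := by gcongr
        _ = f * (1 + θ) ^ 2 := by rw [← hba]; ring
        _ < f₁ := ht1
    · rw [abs_of_pos hb0]; linarith
    · have : 0 < a₁ * t := by positivity
      change m (ρ - t) < m ρ
      linarith
    · change m (ρ - t) ≤ m ρ - a * t + b / 2 * t ^ 2
      rw [ha]; linarith
  -- Maximality at `ρ` turns the values of `m` at `ρ ± t` into upper bounds for `k` at `ρ ∓ t`. They
  -- put `k` on or below the parabola of slope `a` and curvature `-b`, impossible for the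
  -- subsolution `-v`.
  have hk1 := hpair (ρ + t) (ρ - t) (by linarith) (by linarith) (by linarith)
  have hk2 := hpair (ρ - t) (ρ + t) (by linarith) (by linarith) (by linarith)
  refine (hk.mono (hsub (s := ρ + t) (by linarith)) fun _ _ => le_rfl).false_of_ballMax_le
    ht htρ (hvc.neg.mono (hsub (by linarith))) (a := a) (b := -b) (fun s hs₁ hs₂ => ?_) ?_ ?_ ?_ ?_
  · have h1 : b * (s - ρ) ≤ b * t := by gcongr; linarith
    have h3 : a₁ * (1 - θ) ≤ a + -b * (s - ρ) := by linarith
    have h4 : 0 ≤ a₁ * (1 - θ) := mul_nonneg ha0.le (by linarith)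
    have : f * (1 - θ) ^ 2 ≤ b * (a + -b * (s - ρ)) ^ 2 := by
      calc f * (1 - θ) ^ 2 = b * (a₁ * (1 - θ)) ^ 2 := by rw [← hba]; ring
        _ ≤ _ := by gcongr
    linarith
  · rw [abs_neg, abs_of_pos hb0]; linarith
  · change k (ρ - t) < k ρ
    have : 0 < a * t := by positivity
    have : 0 < b / 2 * t ^ 2 := by positivity
    linarith
  · change k (ρ - t) ≤ k ρ - a * t + -b / 2 * t ^ 2
    linarith
  · change k (ρ + t) ≤ k ρ + a * t + -b / 2 * t ^ 2
    rw [ha]; linarith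

/-! ### Comparison principles -/

/-- One constraint radius `R` must fit the local radii `δ` near every relevant pair. If none did,
pairs with `R → 0` would accumulate at a single `p` with `u p - v p ≥ c`, hence at a point of `Ω`,
where `δ p > 0`. -/
lemma exists_scale {K : Set 𝔼} (hK : IsCompact K) (hu : ContinuousOn u K) (hv : ContinuousOn v K)
    {c : ℝ} (hΩ : ∀ x ∈ K, c ≤ u x - v x → x ∈ Ω) {δ : 𝔼 → ℝ} (hδ : ∀ x ∈ Ω, 0 < δ x) :
    ∃ R > 0, ∀ x ∈ K, ∀ y ∈ K, dist x y ≤ R → c ≤ u x - v y →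
      ∃ p ∈ Ω, dist x p < δ p ∧ R < δ p := by
  by_contra! hcon
  choose x hx y hy hxy hc hfar using fun k : ℕ =>
    hcon (1 / ((k : ℝ) + 1)) Nat.one_div_pos_of_nat
  obtain ⟨p, hp, φ, hφ, hlim⟩ := hK.tendsto_subseq hx
  have h0 : Tendsto (fun k => 1 / ((φ k : ℝ) + 1)) atTop (𝓝 0) :=
    tendsto_one_div_add_atTop_nhds_zero_nat.comp hφ.tendsto_atTop
  have hlim' : Tendsto (fun k => y (φ k)) atTop (𝓝 p) := by
    refine hlim.congr_dist ?_
    exact squeeze_zero (fun _ => dist_nonneg) (fun k => hxy (φ k)) h0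
  have h1 : Tendsto (fun k => u (x (φ k))) atTop (𝓝 (u p)) :=
    (hu p hp).tendsto.comp (tendsto_nhdsWithin_iff.2 ⟨hlim, Eventually.of_forall fun k => hx _⟩)
  have h2 : Tendsto (fun k => v (y (φ k))) atTop (𝓝 (v p)) :=
    (hv p hp).tendsto.comp (tendsto_nhdsWithin_iff.2 ⟨hlim', Eventually.of_forall fun k => hy _⟩)
  have hpΩ : p ∈ Ω := hΩ p hp (ge_of_tendsto' (h1.sub h2) fun k => hc (φ k))
  have hd : Tendsto (fun k => dist (x (φ k)) p) atTop (𝓝 0) := tendsto_iff_dist_tendsto_zero.1 hlim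
  obtain ⟨k, hk1, hk2⟩ := ((hd.eventually (gt_mem_nhds (hδ p hpΩ))).and
    (h0.eventually (gt_mem_nhds (hδ p hpΩ)))).exists
  exact absurd hk2 (not_lt.2 (hfar (φ k) p hpΩ hk1))

/-- Among the maximal pairs one with the largest `u` is selected; this tie-break is what the case of
zero right-hand side relies on. -/
lemma exists_max_pair {K : Set 𝔼} (hK : IsCompact K) (hne : K.Nonempty) (hu : ContinuousOn u K)
    (hv : ContinuousOn v K) {R : ℝ} (hR : 0 ≤ R) :
    ∃ x₀ ∈ K, ∃ y₀ ∈ K, dist x₀ y₀ ≤ R ∧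
      (∀ x ∈ K, ∀ y ∈ K, dist x y ≤ R → u x - v y ≤ u x₀ - v y₀) ∧
      ∀ x ∈ K, ∀ y ∈ K, dist x y ≤ R → u x - v y = u x₀ - v y₀ → u x ≤ u x₀ := by
  have hu' : ContinuousOn (fun p : 𝔼 × 𝔼 => u p.1) (K ×ˢ K) :=
    hu.comp continuousOn_fst fun p hp => hp.1
  have hc : ContinuousOn (fun p : 𝔼 × 𝔼 => u p.1 - v p.2) (K ×ˢ K) :=
    hu'.sub (hv.comp continuousOn_snd fun p hp => hp.2)
  set P : Set (𝔼 × 𝔼) := (K ×ˢ K) ∩ {p | dist p.1 p.2 ≤ R}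
  have hP : IsCompact P :=
    (hK.prod hK).inter_right (isClosed_le (continuous_fst.dist continuous_snd) continuous_const)
  obtain ⟨x₁, hx₁⟩ := hne
  obtain ⟨p, hp, hmax⟩ := hP.exists_isMaxOn ⟨(x₁, x₁), ⟨hx₁, hx₁⟩, by simpa using hR⟩
    (hc.mono inter_subset_left)
  set Q : Set (𝔼 × 𝔼) := P ∩ (fun p : 𝔼 × 𝔼 => u p.1 - v p.2) ⁻¹' {u p.1 - v p.2}
  have hQ : IsCompact Q := hP.of_isClosed_subset
    ((hc.mono inter_subset_left).preimage_isClosed_of_isClosed hP.isClosed isClosed_singleton)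
    inter_subset_left
  obtain ⟨q, hq, hqmax⟩ := hQ.exists_isMaxOn ⟨p, hp, rfl⟩
    (hu'.mono (inter_subset_left.trans inter_subset_left))
  have hqp : u q.1 - v q.2 = u p.1 - v p.2 := hq.2
  refine ⟨q.1, hq.1.1.1, q.2, hq.1.1.2, hq.1.2, fun x hx y hy hxy => ?_,
    fun x hx y hy hxy he => ?_⟩
  · rw [hqp]
    exact hmax (show (x, y) ∈ P from ⟨⟨hx, hy⟩, hxy⟩)
  · exact hqmax (show (x, y) ∈ Q from ⟨⟨⟨hx, hy⟩, hxy⟩, he.trans hqp⟩)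

lemma mem_of_lt_sub_of_frontier (hΩ : IsOpen Ω) {κ c : ℝ}
    (hbd : ∀ ξ ∈ frontier Ω, u ξ - v ξ ≤ κ) (hc : κ < c) :
    ∀ x ∈ closure Ω, c ≤ u x - v x → x ∈ Ω := fun x hx h => by
  by_contra hxΩ
  have : x ∈ frontier Ω := by rw [hΩ.frontier_eq]; exact ⟨hx, hxΩ⟩
  linarith [hbd x this]

/-- Comparison for strictly ordered right-hand sides. -/
theorem sub_le_of_strict (hΩ : IsOpen Ω) (hb : Bornology.IsBounded Ω)
    (hu : IsSub Ω F₁ u) (hv : IsSuper Ω F₂ v) (huc : ContinuousOn u (closure Ω))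
    (hvc : ContinuousOn v (closure Ω)) (hF₁ : ContinuousOn F₁ Ω) (hF₂ : ContinuousOn F₂ Ω)
    (hlt : ∀ x ∈ Ω, F₂ x < F₁ x) (hpos : ∀ x ∈ Ω, 0 < F₁ x) {κ : ℝ}
    (hbd : ∀ ξ ∈ frontier Ω, u ξ - v ξ ≤ κ) : ∀ x ∈ Ω, u x - v x ≤ κ := by
  intro x₁ hx₁
  by_contra! hc
  have hloc : ∀ p ∈ Ω, ∃ δ > 0, ∃ f₁ f₂ : ℝ, f₂ < f₁ ∧ 0 < f₁ ∧
      ∀ x ∈ ball p (4 * δ), x ∈ Ω ∧ f₁ ≤ F₁ x ∧ F₂ x ≤ f₂ := by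
    intro p hp
    have h1 := hlt p hp
    have h2 := hpos p hp
    -- The first entry exceeds the midpoint of `F₂ p` and `F₁ p`, which serves as `f₂`; the second
    -- keeps `f₁` positive.
    have e1 := (continuousAt_const (y := max ((3 * F₁ p + F₂ p) / 4) (F₁ p / 2))).eventually_lt
      (hF₁.continuousAt (hΩ.mem_nhds hp)) (max_lt (by linarith) (by linarith))
    have e2 := (hF₂.continuousAt (hΩ.mem_nhds hp)).eventually_lt
      (continuousAt_const (y := (F₁ p + F₂ p) / 2)) (by linarith)
    obtain ⟨r, hr, hball⟩ := Metric.eventually_nhds_iff_ball.1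
      ((hΩ.eventually_mem hp).and (e1.and e2))
    refine ⟨r / 4, by positivity, max ((3 * F₁ p + F₂ p) / 4) (F₁ p / 2), (F₁ p + F₂ p) / 2,
      lt_max_of_lt_left (by linarith), lt_max_of_lt_right (by linarith), fun x hx => ?_⟩
    have := hball x (by simpa [mul_div_cancel₀] using hx)
    exact ⟨this.1, this.2.1.le, this.2.2.le⟩
  choose! δ hδ f₁ f₂ hf hf₁ hball using hloc
  obtain ⟨R, hR, hscale⟩ := exists_scale hb.isCompact_closure huc hvc
    (mem_of_lt_sub_of_frontier hΩ hbd hc) hδ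
  obtain ⟨x₀, hx₀, y₀, hy₀, hd, hmax, -⟩ := exists_max_pair hb.isCompact_closure
    ⟨x₁, subset_closure hx₁⟩ huc hvc hR.le
  obtain ⟨p, hp, hpx, hpR⟩ := hscale x₀ hx₀ y₀ hy₀ hd
    (hmax x₁ (subset_closure hx₁) x₁ (subset_closure hx₁) (by simpa using hR.le))
  have hx₀z : dist x₀ (midpoint ℝ x₀ y₀) ≤ R / 2 := by
    rw [dist_left_midpoint]; simp; linarith
  have hy₀z : dist y₀ (midpoint ℝ x₀ y₀) ≤ R / 2 := by
    rw [dist_right_midpoint]; simp; linarith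
  set z := midpoint ℝ x₀ y₀
  -- The distance to `p` is at most `R + R / 2 + dist x₀ p`, with `R` and `dist x₀ p` below `δ p`.
  have hsub : closedBall z R ⊆ ball p (4 * δ p) := fun x hx => by
    have h1 := dist_triangle4 x z x₀ p
    rw [dist_comm z x₀] at h1
    simp only [mem_closedBall, mem_ball] at hx ⊢
    linarith
  have hsubΩ : closedBall z R ⊆ Ω := fun x hx => (hball p hp x (hsub hx)).1
  exact false_of_max_dist_le hR (hu.mono hsubΩ fun x hx => (hball p hp x (hsub hx)).2.1)
    (hv.mono hsubΩ fun x hx => (hball p hp x (hsub hx)).2.2)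
    (huc.mono (hsubΩ.trans subset_closure)) (hvc.mono (hsubΩ.trans subset_closure))
    (hf p hp) (hf₁ p hp) hx₀z hy₀z
    fun x hx y hy => hmax x (subset_closure (hsubΩ hx)) y (subset_closure (hsubΩ hy))

/-- If `u x - v y` attains its maximum under `dist x y ≤ R`, with the largest possible value of
`u`, in a ball of radius `R / 2` about `z`, then these values are attained at `z`. -/
lemma eq_center_of_max {R A M : ℝ} (hR : 0 < R)
    (hu : IsSub (closedBall z R) (fun _ => 0) u) (hv : IsSuper (closedBall z R) (fun _ => 0) v)
    (huc : ContinuousOn u (closedBall z R)) (hvc : ContinuousOn v (closedBall z R))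
    (hmax : ∀ x ∈ closedBall z R, ∀ y ∈ closedBall z R, dist x y ≤ R → u x - v y ≤ M)
    (hA : ∀ x ∈ closedBall z R, ∀ y ∈ closedBall z R, dist x y ≤ R → u x - v y = M → u x ≤ A)
    {x₀ y₀ : 𝔼} (hx₀ : x₀ ∈ closedBall z (R / 2)) (hy₀ : y₀ ∈ closedBall z (R / 2))
    (hux : u x₀ = A) (hvy : v y₀ = A - M) : u z = A ∧ v z = A - M := by
  have hk : IsSub (closedBall z R) (fun _ => 0) (fun x => -v x) := by simpa using hv.neg
  have hsub : closedBall z (R / 2) ⊆ closedBall z R := closedBall_subset_closedBall (by linarith)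
  have hzR : z ∈ closedBall z R := mem_closedBall_self hR.le
  have h1 := ballMax_neg_add_le (s := R / 2) (s' := R / 2) (by positivity) (by positivity)
    (by ring) huc hvc hmax
  have h2 := le_ballMax (huc.mono hsub) hx₀
  have h3 := le_ballMax (u := fun x => -v x) (hvc.neg.mono hsub) hy₀
  -- At half the radius the chord inequality bounds each maximum by the mean of its values at radii
  -- `0` and `R`. Summed, the two bounds give at most `M`, which is already attained, so all
  -- inequalities are equalities.
  have h4 := hu.ballMax_le_chord (s := R / 2) hR (by positivity) (by linarith) huc
    fun _ _ => le_rfl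
  have h5 := hk.ballMax_le_chord (s := R / 2) hR (by positivity) (by linarith) hvc.neg
    fun _ _ => le_rfl
  have e : ∀ d : ℝ, d / R * (R / 2) = d / 2 := fun d => by field_simp
  rw [e] at h4 h5
  obtain ⟨x', hx', hxm⟩ := exists_eq_ballMax hR.le huc
  obtain ⟨y', hy', hym⟩ := exists_eq_ballMax (u := fun x => -v x) hR.le hvc.neg
  have h6 := hmax x' hx' z hzR hx'
  have h7 := hmax z hzR y' hy' (by rw [dist_comm]; exact hy')
  have h8 := le_ballMax (huc.mono hsub) (mem_closedBall_self (x := z) (half_pos hR).le)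
  -- The pair `(x', z)` is thus maximal too, and the tie-break bounds the maximum of `u` over the
  -- full ball by `A`; this forces `u z = A`.
  have h9 := hA x' hx' z hzR hx' (by linarith)
  constructor <;> linarith

/-- Comparison for `∞`-harmonic functions. -/
theorem sub_le_of_zero (hn : 1 ≤ n) (hΩ : IsOpen Ω) (hb : Bornology.IsBounded Ω)
    (hu : IsSub Ω (fun _ => 0) u) (hv : IsSuper Ω (fun _ => 0) v)
    (huc : ContinuousOn u (closure Ω)) (hvc : ContinuousOn v (closure Ω)) {κ : ℝ}
    (hbd : ∀ ξ ∈ frontier Ω, u ξ - v ξ ≤ κ) : ∀ x ∈ Ω, u x - v x ≤ κ := by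
  intro x₁ hx₁
  by_contra! hc
  have hloc : ∀ p ∈ Ω, ∃ δ > 0, ball p (4 * δ) ⊆ Ω := by
    intro p hp
    obtain ⟨r, hr, hball⟩ := Metric.isOpen_iff.1 hΩ p hp
    exact ⟨r / 4, by positivity, by simpa [mul_div_cancel₀] using hball⟩
  choose! δ hδ hball using hloc
  obtain ⟨R, hR, hscale⟩ := exists_scale hb.isCompact_closure huc hvc
    (mem_of_lt_sub_of_frontier hΩ hbd hc) hδ
  obtain ⟨x₀, hx₀, y₀, hy₀, hd, hmax, hA⟩ := exists_max_pair hb.isCompact_closure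
    ⟨x₁, subset_closure hx₁⟩ huc hvc hR.le
  have hMc := hmax x₁ (subset_closure hx₁) x₁ (subset_closure hx₁) (by simpa using hR.le)
  have hcenter : ∀ x ∈ closure Ω, ∀ y ∈ closure Ω, dist x y ≤ R → u x = u x₀ → v y = v y₀ →
      ∀ z, dist x z ≤ R / 2 → dist y z ≤ R / 2 → z ∈ Ω ∧ u z = u x₀ ∧ v z = v y₀ := by
    intro x hx y hy hxy hux hvy z hxz hyz
    obtain ⟨p, hp, hpx, hpR⟩ := hscale x hx y hy hxy (by rw [hux, hvy]; exact hMc)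
    have hsubΩ : closedBall z R ⊆ Ω := fun a ha => hball p hp (by
      have h1 := dist_triangle4 a z x p
      rw [dist_comm z x] at h1
      simp only [mem_closedBall, mem_ball] at ha ⊢
      linarith)
    have hsub' := hsubΩ.trans subset_closure
    have := eq_center_of_max hR (hu.mono hsubΩ fun _ _ => le_rfl)
      (hv.mono hsubΩ fun _ _ => le_rfl) (huc.mono hsub') (hvc.mono hsub')
      (fun a ha b hb => hmax a (hsub' ha) b (hsub' hb))
      (fun a ha b hb => hA a (hsub' ha) b (hsub' hb)) hxz hyz hux (by rw [hvy]; ring)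
    exact ⟨hsubΩ (mem_closedBall_self hR.le), this.1, by rw [this.2]; ring⟩
  -- The midpoint of the maximal pair lies in `D`. Each point of `D`, paired with itself, is again
  -- maximal, so with it `D` contains a ball of the fixed radius `R / 2`. A nonempty bounded set
  -- that is open and closed cannot exist.
  set D : Set 𝔼 := {x | x ∈ Ω ∧ u x = u x₀ ∧ v x = v y₀} with hD
  have hDne : D.Nonempty := ⟨midpoint ℝ x₀ y₀, hcenter x₀ hx₀ y₀ hy₀ hd rfl rfl _
    (by rw [dist_left_midpoint]; simp; linarith) (by rw [dist_right_midpoint]; simp; linarith)⟩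
  have hDo : IsOpen D := by
    refine Metric.isOpen_iff.2 fun x hx => ⟨R / 2, by positivity, fun z hz => ?_⟩
    have hz' : dist x z ≤ R / 2 := by rw [dist_comm]; exact le_of_lt hz
    exact hcenter x (subset_closure hx.1) x (subset_closure hx.1) (by simpa using hR.le)
      hx.2.1 hx.2.2 z hz' hz'
  have hDc : IsClosed D := by
    have h1 : IsClosed (closure Ω ∩ u ⁻¹' {u x₀}) :=
      huc.preimage_isClosed_of_isClosed isClosed_closure isClosed_singleton
    have h2 : IsClosed (closure Ω ∩ v ⁻¹' {v y₀}) :=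
      hvc.preimage_isClosed_of_isClosed isClosed_closure isClosed_singleton
    have : D = (closure Ω ∩ u ⁻¹' {u x₀}) ∩ (closure Ω ∩ v ⁻¹' {v y₀}) := by
      ext x
      refine ⟨fun h => ⟨⟨subset_closure h.1, h.2.1⟩, ⟨subset_closure h.1, h.2.2⟩⟩, fun h => ?_⟩
      have hux : u x = u x₀ := h.1.2
      have hvx : v x = v y₀ := h.2.2
      exact hcenter x h.1.1 x h.1.1 (by simpa using hR.le) hux hvx x (by simp; positivity)
        (by simp; positivity)
    rw [this]
    exact h1.inter h2
  obtain ⟨ξ, hξ⟩ := nonempty_frontier_of_isBounded hn hDne (hb.subset fun x hx => hx.1)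
  rw [(isClopen_iff_frontier_eq_empty (s := D)).1 ⟨hDc, hDo⟩] at hξ
  exact hξ

end

section

/-! ### Uniqueness of real-valued solutions -/

variable {Ω : Set (EuclideanSpace ℝ (Fin n))} {F g h h₁ h₂ w : EuclideanSpace ℝ (Fin n) → ℝ}
  {V : EuclideanSpace ℝ (Fin n) → EReal}

/-- Real-valued solutions on `Ω`, continuous up to the boundary, with boundary values `g`. -/
structure IsDirichletSolution (Ω : Set 𝔼) (F g h : 𝔼 → ℝ) : Prop where
  continuousOn : ContinuousOn h (closure Ω)
  isSuper : IsSuper Ω F h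
  isSub : IsSub Ω F h
  eq_frontier : ∀ ξ ∈ frontier Ω, h ξ = g ξ

lemma IsDirichletSolution.neg (hh : IsDirichletSolution Ω F g h) :
    IsDirichletSolution Ω (fun x => -F x) (fun x => -g x) (fun x => -h x) :=
  ⟨hh.continuousOn.neg, hh.isSub.neg, hh.isSuper.neg,
    fun ξ hξ => by rw [hh.eq_frontier ξ hξ]⟩

/-- The multiple `(1 + ε) h₁` solves the equation with right-hand side `(1 + ε) ^ 3 F > F`, and its
boundary values change by at most `ε B`. -/
lemma IsDirichletSolution.le_of_pos (hΩ : IsOpen Ω) (hb : Bornology.IsBounded Ω)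
    (hF : ContinuousOn F Ω) (hpos : ∀ x ∈ Ω, 0 < F x) (hh₁ : IsDirichletSolution Ω F g h₁)
    (hh₂ : IsDirichletSolution Ω F g h₂) : ∀ x ∈ Ω, h₁ x ≤ h₂ x := by
  intro x hx
  by_contra! hlt
  obtain ⟨B, hB⟩ := hb.isCompact_closure.exists_bound_of_continuousOn hh₁.continuousOn
  have hB0 : 0 ≤ B := (norm_nonneg _).trans (hB x (subset_closure hx))
  set μ := h₁ x - h₂ x with hμ
  have hμ0 : 0 < μ := by linarith
  -- Comparison at `x` yields `μ ≤ 2 * B * ε`, and this choice makes the right side smaller than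
  -- `μ`.
  set ε := μ / (2 * B + 1) with hε
  have hε0 : 0 < ε := by positivity
  have hεB : ε * (2 * B + 1) = μ := by rw [hε]; field_simp
  have h1 : 1 < (1 + ε) ^ 3 := one_lt_pow₀ (by linarith) (by norm_num)
  have key := sub_le_of_strict (κ := ε * B) hΩ hb (hh₁.isSub.const_mul (c := 1 + ε) (by linarith))
    hh₂.isSuper (continuousOn_const.mul hh₁.continuousOn) hh₂.continuousOn
    (continuousOn_const.mul hF) hF (fun y hy => by nlinarith [hpos y hy])
    (fun y hy => mul_pos (by positivity) (hpos y hy)) (fun ξ hξ => by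
      have := (abs_le.1 (hB ξ (frontier_subset_closure hξ))).2
      rw [hh₂.eq_frontier ξ hξ, ← hh₁.eq_frontier ξ hξ]
      nlinarith) x hx
  have h2 := (abs_le.1 (hB x (subset_closure hx))).1
  nlinarith

lemma IsDirichletSolution.eq_of_pos (hΩ : IsOpen Ω) (hb : Bornology.IsBounded Ω)
    (hF : ContinuousOn F Ω) (hpos : ∀ x ∈ Ω, 0 < F x) (hh₁ : IsDirichletSolution Ω F g h₁)
    (hh₂ : IsDirichletSolution Ω F g h₂) : ∀ x ∈ Ω, h₁ x = h₂ x := fun x hx =>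
  le_antisymm (hh₁.le_of_pos hΩ hb hF hpos hh₂ x hx) (hh₂.le_of_pos hΩ hb hF hpos hh₁ x hx)

/-- By the intermediate value theorem `F` has one sign on `Ω`; the negative case reduces to the
positive one by negating everything. -/
theorem IsDirichletSolution.eq_of_bounded_away (hΩ : IsOpen Ω) (hconn : IsPreconnected Ω)
    (hb : Bornology.IsBounded Ω) (hF : ContinuousOn F Ω) {c : ℝ} (hc : 0 < c)
    (hFc : ∀ x ∈ Ω, c ≤ |F x|) (hh₁ : IsDirichletSolution Ω F g h₁)
    (hh₂ : IsDirichletSolution Ω F g h₂) : ∀ x ∈ Ω, h₁ x = h₂ x := by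
  have hne : ∀ x ∈ Ω, F x ≠ 0 := fun x hx h0 => by
    have := hFc x hx
    rw [h0, abs_zero] at this
    linarith
  by_cases hpos : ∀ x ∈ Ω, 0 < F x
  · exact hh₁.eq_of_pos hΩ hb hF hpos hh₂
  · push Not at hpos
    obtain ⟨a, ha, haF⟩ := hpos
    have hneg : ∀ x ∈ Ω, 0 < -F x := fun x hx => by
      by_contra! hx0
      obtain ⟨y, hy, hy0⟩ := hconn.intermediate_value ha hx hF
        (show (0 : ℝ) ∈ Icc (F a) (F x) from ⟨haF, by linarith⟩)
      exact hne y hy hy0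
    intro x hx
    have := hh₁.neg.eq_of_pos hΩ hb hF.neg hneg hh₂.neg x hx
    linarith

theorem IsDirichletSolution.eq_of_zero (hn : 1 ≤ n) (hΩ : IsOpen Ω) (hb : Bornology.IsBounded Ω)
    (hF : ∀ x ∈ Ω, F x = 0) (hh₁ : IsDirichletSolution Ω F g h₁)
    (hh₂ : IsDirichletSolution Ω F g h₂) : ∀ x ∈ Ω, h₁ x = h₂ x := by
  have key : ∀ {h₁ h₂ : 𝔼 → ℝ}, IsDirichletSolution Ω F g h₁ → IsDirichletSolution Ω F g h₂ →
      ∀ x ∈ Ω, h₁ x ≤ h₂ x := fun hh₁ hh₂ x hx => by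
    have := sub_le_of_zero (κ := 0) hn hΩ hb (hh₁.isSub.mono subset_rfl fun y hy => (hF y hy).ge)
      (hh₂.isSuper.mono subset_rfl fun y hy => (hF y hy).le) hh₁.continuousOn hh₂.continuousOn
      (fun ξ hξ => by rw [hh₁.eq_frontier ξ hξ, hh₂.eq_frontier ξ hξ, sub_self]) x hx
    linarith
  exact fun x hx => le_antisymm (key hh₁ hh₂ x hx) (key hh₂ hh₁ x hx)

/-! ### Extended-real-valued solutions -/

lemma neBot_nhdsWithin_of_mem_frontier {ξ : 𝔼} (hξ : ξ ∈ frontier Ω) : (𝓝[Ω] ξ).NeBot :=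
  mem_closure_iff_nhdsWithin_neBot.1 (frontier_subset_closure hξ)

lemma IsDirichletSolution.isViscositySolution (hΩ : IsOpen Ω) (hh : IsDirichletSolution Ω F g h)
    (hV : ∀ x ∈ Ω, V x = h x) : IsViscositySolution Ω F V := by
  have hc : ContinuousOn h Ω := hh.continuousOn.mono subset_closure
  refine ⟨(continuous_coe_real_ereal.comp_continuousOn hc).congr hV,
    hh.isSuper.isViscositySupersolution hΩ hc.lowerSemicontinuousOn hV, ?_⟩
  have := (hh.isSub.neg.isViscositySupersolution hΩ (V := fun x => -V x)
    hc.neg.lowerSemicontinuousOn fun x hx => by rw [hV x hx, EReal.coe_neg]).neg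
  simpa using this

lemma IsDirichletSolution.hasBoundaryValues (hh : IsDirichletSolution Ω F g h)
    (hV : ∀ x ∈ Ω, V x = h x) : HasBoundaryValues Ω g V := by
  intro ξ hξ
  have h1 : Tendsto h (𝓝[Ω] ξ) (𝓝 (g ξ)) := by
    have := (hh.continuousOn ξ (frontier_subset_closure hξ)).mono subset_closure
    rwa [ContinuousWithinAt, hh.eq_frontier ξ hξ] at this
  refine ((continuous_coe_real_ereal.tendsto (g ξ)).comp h1).congr' ?_
  filter_upwards [self_mem_nhdsWithin] with x hx using (hV x hx).symm

/-- Extension by `g` is continuous on the compact closure, hence bounded, and boundedness is what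
permits local test functions. -/
lemma IsViscositySolution.exists_isDirichletSolution (hΩ : IsOpen Ω)
    (hb : Bornology.IsBounded Ω) (hg : ContinuousOn g (frontier Ω))
    (hV : IsViscositySolution Ω F V) (hVg : HasBoundaryValues Ω g V) :
    ∃ h, IsDirichletSolution Ω F g h ∧ ∀ x ∈ Ω, V x = h x := by
  classical
  let h : 𝔼 → ℝ := fun x => if x ∈ Ω then (V x).toReal else g x
  have hΩV : ∀ x ∈ Ω, V x = h x := fun x hx => by
    simp only [h, if_pos hx]
    exact (EReal.coe_toReal (hV.subsolution.ne_top x hx) (hV.supersolution.ne_bot x hx)).symm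
  have hfr : ∀ ξ ∈ frontier Ω, h ξ = g ξ := fun ξ hξ =>
    if_neg fun hξΩ => ne_of_mem_frontier hΩ hξ hξΩ rfl
  have hc : ContinuousOn h (closure Ω) := by
    intro x hx
    by_cases hxΩ : x ∈ Ω
    · refine ContinuousAt.continuousWithinAt ?_
      have h1 : Tendsto (fun y => (V y).toReal) (𝓝 x) (𝓝 (V x).toReal) :=
        (EReal.tendsto_toReal (hV.subsolution.ne_top x hxΩ)
          (hV.supersolution.ne_bot x hxΩ)).comp (hV.continuousOn.continuousAt (hΩ.mem_nhds hxΩ))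
      have h2 : ContinuousAt (fun y => (V y).toReal) x := h1
      refine h2.congr ?_
      filter_upwards [hΩ.mem_nhds hxΩ] with y hy
      exact (if_pos hy).symm
    · have hξ : x ∈ frontier Ω := by rw [hΩ.frontier_eq]; exact ⟨hx, hxΩ⟩
      rw [closure_eq_self_union_frontier]
      refine ContinuousWithinAt.union ?_ ?_
      · rw [ContinuousWithinAt, hfr x hξ]
        have h1 := (EReal.tendsto_toReal (EReal.coe_ne_top (g x)) (EReal.coe_ne_bot (g x))).comp
          (hVg x hξ)
        refine h1.congr' ?_
        filter_upwards [self_mem_nhdsWithin] with y hy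
        exact (if_pos hy).symm
      · exact (hg x hξ).congr hfr (hfr x hξ)
  obtain ⟨M, hM⟩ := hb.isCompact_closure.exists_bound_of_continuousOn hc
  have hlow : ∀ x ∈ Ω, -M ≤ h x := fun x hx => (abs_le.1 (hM x (subset_closure hx))).1
  have hupp : ∀ x ∈ Ω, -M ≤ -h x := fun x hx => by
    linarith [(abs_le.1 (hM x (subset_closure hx))).2]
  refine ⟨h, ⟨hc, hV.supersolution.isSuper hΩ hΩV hlow, ?_, hfr⟩, hΩV⟩
  have := (hV.subsolution.neg.isSuper hΩ (v := fun x => -h x)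
    (fun x hx => by rw [hΩV x hx, EReal.coe_neg]) hupp).neg
  simpa using this

/-! ### The Perron solutions -/

lemma IsViscositySupersolution.min (hΩ : IsOpen Ω) (hV : IsViscositySupersolution Ω F V)
    (hw : IsSuper Ω F w) (hwc : Continuous w) :
    IsViscositySupersolution Ω F fun x => min (V x) (w x) where
  ne_bot x hx := by
    rcases min_choice (V x) (w x : EReal) with h | h <;> rw [h]
    · exact hV.ne_bot x hx
    · exact EReal.coe_ne_bot _
  lsc := hV.lsc.inf
    (continuous_coe_real_ereal.comp hwc).continuousOn.lowerSemicontinuousOn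
  le_of_touches x hx φ hφ ht := by
    rcases min_choice (V x) (w x : EReal) with h | h
    · exact hV.le_of_touches x hx φ hφ ⟨h.symm.trans ht.1, fun y hy hne =>
        (ht.2 y hy hne).trans_le (min_le_left _ _)⟩
    · have h1 : φ x = w x :=
        (EReal.coe_eq_coe_iff.1 (h.symm.trans ht.1)).symm
      refine hw x hx φ (hφ.contDiffAt (hΩ.mem_nhds hx)) h1 ?_
      filter_upwards [hΩ.mem_nhds hx] with y hy
      rcases eq_or_ne y x with rfl | hne
      · exact h1.le
      · exact (EReal.coe_lt_coe_iff.1 ((ht.2 y hy hne).trans_le (min_le_right _ _))).le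

/-- A member of the upper class may be infinite or unbounded; its minimum with `w`, extended by `g`,
is a real competitor. The liminf condition is precisely lower semicontinuity of this extension at
the boundary. -/
lemma exists_real_le_of_mem_upperClass (hΩ : IsOpen Ω) (hb : Bornology.IsBounded Ω)
    (hne : Ω.Nonempty) (hg : ContinuousOn g (frontier Ω)) (hw : IsSuper Ω F w)
    (hwc : Continuous w) (hgw : ∀ ξ ∈ frontier Ω, g ξ ≤ w ξ) (hV : V ∈ upperClass Ω F g) :
    ∃ v : 𝔼 → ℝ, LowerSemicontinuousOn v (closure Ω) ∧ IsSuper Ω F v ∧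
      (∀ ξ ∈ frontier Ω, g ξ ≤ v ξ) ∧ ∀ x ∈ Ω, (v x : EReal) ≤ V x := by
  classical
  have hmin := hV.1.min hΩ hw hwc
  let v : 𝔼 → ℝ := fun x => if x ∈ Ω then (min (V x) (w x)).toReal else g x
  have hvΩ : ∀ x ∈ Ω, min (V x) (w x) = (v x : EReal) := fun x hx => by
    simp only [v, if_pos hx]
    refine (EReal.coe_toReal (ne_top_of_le_ne_top (EReal.coe_ne_top _) (min_le_right _ _))
      (hmin.ne_bot x hx)).symm
  have hfr : ∀ ξ ∈ frontier Ω, v ξ = g ξ := fun ξ hξ =>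
    if_neg fun hξΩ => ne_of_mem_frontier hΩ hξ hξΩ rfl
  have hlsc : LowerSemicontinuousOn v (closure Ω) := by
    intro x hx y hy
    change y < v x at hy
    change ∀ᶠ z in 𝓝[closure Ω] x, y < v z
    by_cases hxΩ : x ∈ Ω
    · have h1 : (y : EReal) < min (V x) (w x) := by
        rw [hvΩ x hxΩ]; exact EReal.coe_lt_coe_iff.2 hy
      have h2 := hmin.lsc x hxΩ y h1
      rw [hΩ.nhdsWithin_eq hxΩ] at h2
      refine eventually_nhdsWithin_of_eventually_nhds ?_
      filter_upwards [h2, hΩ.mem_nhds hxΩ] with z hz hzΩ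
      have hz' : (y : EReal) < min (V z) (w z) := hz
      rw [hvΩ z hzΩ] at hz'
      exact EReal.coe_lt_coe_iff.1 hz'
    · have hξ : x ∈ frontier Ω := by rw [hΩ.frontier_eq]; exact ⟨hx, hxΩ⟩
      rw [hfr x hξ] at hy
      rw [closure_eq_self_union_frontier, nhdsWithin_union, eventually_sup]
      constructor
      · have h1 : ∀ᶠ z in 𝓝[Ω] x, (y : EReal) < V z :=
          eventually_lt_of_lt_liminf ((EReal.coe_lt_coe_iff.2 hy).trans_le (hV.2 x hξ))
        have h2 : ∀ᶠ z in 𝓝[Ω] x, y < w z := eventually_nhdsWithin_of_eventually_nhds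
          (hwc.continuousAt.eventually (lt_mem_nhds (hy.trans_le (hgw x hξ))))
        filter_upwards [h1, h2, self_mem_nhdsWithin] with z hz1 hz2 hzΩ
        have : (y : EReal) < min (V z) (w z) := lt_min hz1 (EReal.coe_lt_coe_iff.2 hz2)
        rw [hvΩ z hzΩ] at this
        exact EReal.coe_lt_coe_iff.1 this
      · filter_upwards [(hg x hξ).eventually (lt_mem_nhds hy), self_mem_nhdsWithin] with z hz hzξ
        rwa [hfr z hzξ]
  -- Lower semicontinuity on a compact set supplies the lower bound needed to localize test
  -- functions.
  obtain ⟨x₁, -, hx₁⟩ := hlsc.exists_isMinOn hne.closure hb.isCompact_closure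
  exact ⟨v, hlsc, hmin.isSuper hΩ hvΩ fun x hx => hx₁ (subset_closure hx),
    fun ξ hξ => (hfr ξ hξ).ge, fun x hx => (hvΩ x hx).symm.trans_le (min_le_left _ _)⟩

lemma IsDirichletSolution.mem_upperClass (hΩ : IsOpen Ω) (hh : IsDirichletSolution Ω F g h)
    (hV : ∀ x ∈ Ω, V x = h x) : V ∈ upperClass Ω F g :=
  ⟨(hh.isViscositySolution hΩ hV).supersolution, fun ξ hξ => by
    have := neBot_nhdsWithin_of_mem_frontier hξ
    exact (hh.hasBoundaryValues hV ξ hξ).liminf_eq.ge⟩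

theorem exists_isDirichletSolution_eq_upperPerron (hn : 1 ≤ n) (hΩ : IsOpen Ω)
    (hne : Ω.Nonempty) (hb : Bornology.IsBounded Ω) (hF : ContinuousOn F Ω)
    (hFb : ∃ C : ℝ, ∀ x ∈ Ω, |F x| ≤ C) (hg : ContinuousOn g (frontier Ω)) :
    ∃ h, IsDirichletSolution Ω F g h ∧ ∀ x ∈ Ω, upperPerron Ω F g x = h x := by
  obtain ⟨h, h1, h2, h3, h4, hmin⟩ := exists_minimal_solution hn hΩ hne hb hF hFb hg
  have hh : IsDirichletSolution Ω F g h := ⟨h1, h2, h3, h4⟩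
  obtain ⟨ξ, hξ⟩ := nonempty_frontier_of_isBounded hn hne hb
  obtain ⟨B, hB, hBg⟩ := exists_upper_barrier hΩ hb hFb hg hξ one_pos
  refine ⟨h, hh, fun x hx => le_antisymm
    (iInf₂_le (fun x => (h x : EReal)) (hh.mem_upperClass hΩ fun _ _ => rfl))
    (le_iInf₂ fun V hV => ?_)⟩
  obtain ⟨v, hv1, hv2, hv3, hv4⟩ := exists_real_le_of_mem_upperClass hΩ hb hne hg
    (IsSuper.of_contDiffAt fun y hy =>
      ⟨contDiffAt_quadCone _ _ _ (ne_of_mem_frontier hΩ hξ hy), (hB y hy).le⟩)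
    (continuous_quadCone _ _ _ _) hBg hV
  exact (EReal.coe_le_coe_iff.2 (hmin v hv1 hv2 hv3 x (subset_closure hx))).trans (hv4 x hx)

lemma neg_mem_upperClass (hV : V ∈ lowerClass Ω F g) :
    (fun x => -V x) ∈ upperClass Ω (fun x => -F x) fun x => -g x :=
  ⟨hV.1.neg, fun ξ hξ => by
    have := EReal.liminf_neg (v := V) (f := 𝓝[Ω] ξ)
    change _ ≤ liminf (-V) (𝓝[Ω] ξ)
    rw [this, EReal.coe_neg]
    exact EReal.neg_le_neg_iff.2 (hV.2 ξ hξ)⟩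

lemma neg_mem_lowerClass (hV : V ∈ upperClass Ω F g) :
    (fun x => -V x) ∈ lowerClass Ω (fun x => -F x) fun x => -g x :=
  ⟨hV.1.neg, fun ξ hξ => by
    have := EReal.limsup_neg (v := V) (f := 𝓝[Ω] ξ)
    change limsup (-V) (𝓝[Ω] ξ) ≤ _
    rw [this, EReal.coe_neg]
    exact EReal.neg_le_neg_iff.2 (hV.2 ξ hξ)⟩

/-- Since `Δ_∞` is odd, negation exchanges the two Perron classes for the data `F, g` and `-F, -g`.
-/
lemma lowerPerron_eq_neg_upperPerron (x : 𝔼) :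
    lowerPerron Ω F g x = -upperPerron Ω (fun x => -F x) (fun x => -g x) x := by
  refine le_antisymm (iSup₂_le fun V hV => EReal.le_neg_of_le_neg ?_) (EReal.neg_le_of_neg_le ?_)
  · exact iInf₂_le (fun x => -V x) (neg_mem_upperClass hV)
  · refine le_iInf₂ fun V hV => EReal.neg_le_of_neg_le ?_
    have := neg_mem_lowerClass hV
    simp only [neg_neg] at this
    exact le_iSup₂ (f := fun (u : 𝔼 → EReal) (_ : u ∈ lowerClass Ω F g) => u x) (fun x => -V x) this

theorem exists_isDirichletSolution_eq_lowerPerron (hn : 1 ≤ n) (hΩ : IsOpen Ω)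
    (hne : Ω.Nonempty) (hb : Bornology.IsBounded Ω) (hF : ContinuousOn F Ω)
    (hFb : ∃ C : ℝ, ∀ x ∈ Ω, |F x| ≤ C) (hg : ContinuousOn g (frontier Ω)) :
    ∃ h, IsDirichletSolution Ω F g h ∧ ∀ x ∈ Ω, lowerPerron Ω F g x = h x := by
  obtain ⟨h, hh, heq⟩ := exists_isDirichletSolution_eq_upperPerron (F := fun x => -F x)
    (g := fun x => -g x) hn hΩ hne hb hF.neg (by simpa using hFb) hg.neg
  refine ⟨fun x => -h x, by simpa using hh.neg, fun x hx => ?_⟩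
  rw [lowerPerron_eq_neg_upperPerron, heq x hx, EReal.coe_neg]

lemma IsDirichletSolution.upperPerron_le (hΩ : IsOpen Ω) (hh : IsDirichletSolution Ω F g h)
    (hV : ∀ x ∈ Ω, V x = h x) (x : 𝔼) : upperPerron Ω F g x ≤ V x :=
  iInf₂_le V (hh.mem_upperClass hΩ hV)

lemma IsDirichletSolution.le_lowerPerron (hΩ : IsOpen Ω) (hh : IsDirichletSolution Ω F g h)
    (hV : ∀ x ∈ Ω, V x = h x) (x : 𝔼) : V x ≤ lowerPerron Ω F g x := by
  rw [lowerPerron_eq_neg_upperPerron]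
  exact EReal.le_neg_of_le_neg (hh.neg.upperPerron_le hΩ (V := fun x => -V x)
    (fun x hx => by rw [hV x hx, EReal.coe_neg]) x)

end

end InfPoisson


/-! ### The Dirichlet problem for the extended-real-valued Perron functions. -/

theorem mainTheorem12 (n : ℕ) (hn : 1 ≤ n) (Ω : Set (EuclideanSpace ℝ (Fin n)))
    (hΩ_open : IsOpen Ω) (hΩ_conn : IsConnected Ω) (hΩ_bdd : Bornology.IsBounded Ω)
    (F : EuclideanSpace ℝ (Fin n) → ℝ) (hF_cont : ContinuousOn F Ω)
    (hF_bdd : ∃ C : ℝ, ∀ x ∈ Ω, |F x| ≤ C)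
    (g : EuclideanSpace ℝ (Fin n) → ℝ) (hg_cont : ContinuousOn g (frontier Ω)) :
    (InfPoisson.IsViscositySolution Ω F (InfPoisson.upperPerron Ω F g) ∧
      InfPoisson.HasBoundaryValues Ω g (InfPoisson.upperPerron Ω F g)) ∧
    (InfPoisson.IsViscositySolution Ω F (InfPoisson.lowerPerron Ω F g) ∧
      InfPoisson.HasBoundaryValues Ω g (InfPoisson.lowerPerron Ω F g)) ∧
    (∀ h : EuclideanSpace ℝ (Fin n) → EReal,
      InfPoisson.IsViscositySolution Ω F h → InfPoisson.HasBoundaryValues Ω g h →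
        ∀ x ∈ Ω, InfPoisson.upperPerron Ω F g x ≤ h x ∧ h x ≤ InfPoisson.lowerPerron Ω F g x) ∧
    (((∃ c : ℝ, 0 < c ∧ ∀ x ∈ Ω, c ≤ |F x|) ∨ (∀ x ∈ Ω, F x = 0)) →
      (∀ x ∈ Ω, InfPoisson.upperPerron Ω F g x = InfPoisson.lowerPerron Ω F g x) ∧
      (∀ h₁ h₂ : EuclideanSpace ℝ (Fin n) → EReal,
        InfPoisson.IsViscositySolution Ω F h₁ → InfPoisson.HasBoundaryValues Ω g h₁ →
        InfPoisson.IsViscositySolution Ω F h₂ → InfPoisson.HasBoundaryValues Ω g h₂ →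
          ∀ x ∈ Ω, h₁ x = h₂ x)) := by
  obtain ⟨H, hH, hHeq⟩ := InfPoisson.exists_isDirichletSolution_eq_upperPerron hn hΩ_open
    hΩ_conn.nonempty hΩ_bdd hF_cont hF_bdd hg_cont
  obtain ⟨L, hL, hLeq⟩ := InfPoisson.exists_isDirichletSolution_eq_lowerPerron hn hΩ_open
    hΩ_conn.nonempty hΩ_bdd hF_cont hF_bdd hg_cont
  refine ⟨⟨hH.isViscositySolution hΩ_open hHeq, hH.hasBoundaryValues hHeq⟩,
    ⟨hL.isViscositySolution hΩ_open hLeq, hL.hasBoundaryValues hLeq⟩, fun h hs hbv x _ => ?_,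
    fun hF => ?_⟩
  · obtain ⟨k, hk, hkeq⟩ := hs.exists_isDirichletSolution hΩ_open hΩ_bdd hg_cont hbv
    exact ⟨hk.upperPerron_le hΩ_open hkeq x, hk.le_lowerPerron hΩ_open hkeq x⟩
  · have huniq : ∀ {k₁ k₂ : EuclideanSpace ℝ (Fin n) → ℝ},
        InfPoisson.IsDirichletSolution Ω F g k₁ → InfPoisson.IsDirichletSolution Ω F g k₂ →
          ∀ x ∈ Ω, k₁ x = k₂ x := by
      intro k₁ k₂ hk₁ hk₂
      rcases hF with ⟨c, hc, hFc⟩ | hF0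
      · exact hk₁.eq_of_bounded_away hΩ_open hΩ_conn.isPreconnected hΩ_bdd hF_cont hc hFc hk₂
      · exact hk₁.eq_of_zero hn hΩ_open hΩ_bdd hF0 hk₂
    refine ⟨fun x hx => by rw [hHeq x hx, hLeq x hx, huniq hH hL x hx],
      fun h₁ h₂ hs₁ hb₁ hs₂ hb₂ x hx => ?_⟩
    obtain ⟨k₁, hk₁, he₁⟩ := hs₁.exists_isDirichletSolution hΩ_open hΩ_bdd hg_cont hb₁
    obtain ⟨k₂, hk₂, he₂⟩ := hs₂.exists_isDirichletSolution hΩ_open hΩ_bdd hg_cont hb₂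
    rw [he₁ x hx, he₂ x hx, huniq hk₁ hk₂ x hx]
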